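/- Let $\beta>0$, $\lambda>0$, $\nu\in(0,1]$, and let $N\ge 1$ be an integer. Consider the following generalized Yule model. Webpages are created according to a Yule process (linear birth process) of rate $\beta$ which starts at time $0$ with one webpage. Each webpage starts with one in-link, and the numbers of in-links of the webpages, as functions of the age of the webpage, are independent copies of a fractional nonlinear birth process $\mathfrak N^\nu(t)$, $t\ge0$, independent of the process of creation of webpages, with the saturating rates $\lambda_j=\lambda(N-j)$ for $1\le j\le N$ (the state $N$ is absorbing; put $\lambda_j=0$ for $j>N$). That is, $\mathfrak N^\nu$ is a counting process with unit jumps and $\mathfrak N^\nu(0)=1$ whose state probabilities $p_n(t)=\mathbb P(\mathfrak N^\nu(t)=n)$ are locally absolutely continuous and satisfy $$\frac{\mathrm d^\nu p_n}{\mathrm dt^\nu}=-\lambda_n p_n+\lambda_{n-1}p_{n-1},\quad n\ge1,\qquad p_0\equiv 0,\quad p_n(0)=\delta_{n,1},$$ for almost every $t>0$, where $\mathrm d^\nu/\mathrm dt^\nu$ is the Caputo derivative $\frac{\mathrm d^\nu f}{\mathrm dt^\nu}(t)=\frac1{\Gamma(1-\nu)}\int_0^t (t-s)^{-\nu}f'(s)\,\mathrm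 ds$ for $0<\nu<1$, and the ordinary derivative for $\nu=1$. Let ${}_t\mathfrak N^\nu_{s_1}$ be the number of in-links, at time $t$, of a webpage chosen uniformly at random among those present at time $t$. Then, as $t\to\infty$, ${}_t\mathfrak N^\nu_{s_1}$ converges in distribution to a random variable $\mathfrak N^\nu_{s_1}$, i.e. $\mathbb P({}_t\mathfrak N^\nu_{s_1}=n)\to\mathbb P(\mathfrak N^\nu_{s_1}=n)$ for every integer $n\ge0$, and, with $\rho=\lambda/\beta^\nu$, $$\mathbb P(\mathfrak N^\nu_{s_1}=n)=\binom{N-1}{N-n}\sum_{m=1}^n\binom{n-1}{m-1}(-1)^{n-m}\frac1{1+\rho(N-m)},\qquad 1\le n\le N.$$ -/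

import Mathlib

open MeasureTheory ProbabilityTheory Filter Topology
open scoped NNReal

noncomputable section

namespace FracYule

/-- The Caputo derivative of order `ν ∈ (0, 1]` with base point `0`; at `ν = 1` it is the
ordinary first derivative. -/
def caputoDeriv (ν : ℝ) (f : ℝ → ℝ) (t : ℝ) : ℝ :=
  if ν = 1 then deriv f t
  else (Real.Gamma (1 - ν))⁻¹ * ∫ s in (0 : ℝ)..t, (t - s) ^ (-ν) * deriv f s

section Network

variable {Ω : Type*}

/-- Creation time of webpage `k`; webpage `0` is present from time `0` on. -/
def creationTime (W : ℕ → Ω → ℝ) (k : ℕ) (ω : Ω) : ℝ := ∑ i ∈ Finset.range k, W i ω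

/-- The set of the webpages present at time `t`. -/
def pagesAt (W : ℕ → Ω → ℝ) (t : ℝ≥0) (ω : Ω) : Set ℕ := {k | creationTime W k ω ≤ t}

/-- The number of in-links, at time `t`, of the webpage `K ω`. -/
def pageSize (W : ℕ → Ω → ℝ) (M : ℕ → ℝ≥0 → Ω → ℕ) (t : ℝ≥0) (K : Ω → ℕ) (ω : Ω) : ℕ :=
  M (K ω) (t - creationTime W (K ω) ω).toNNReal ω

/-- The sigma-algebras generated by the single holding times `W i` of the webpage process
(left summand) and by the single in-link processes `M k` (right summand). -/
abbrev componentSigma (W : ℕ → Ω → ℝ) (M : ℕ → ℝ≥0 → Ω → ℕ) : ℕ ⊕ ℕ → MeasurableSpace Ω :=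
  Sum.elim (fun i => MeasurableSpace.comap (W i) inferInstance)
    (fun k => ⨆ s, MeasurableSpace.comap (M k s) inferInstance)

/-- The sigma-algebra generated by the whole network: all webpage creation times and all in-link
processes. -/
abbrev networkSigma (W : ℕ → Ω → ℝ) (M : ℕ → ℝ≥0 → Ω → ℕ) : MeasurableSpace Ω :=
  ⨆ i, componentSigma W M i

end Network

section Model

variable {Ω : Type*} [MeasurableSpace Ω]

/-- The state probability `p_n(t) = P(X(t) = n)` as a function of `t ≥ 0`
(extended by its value at `0` to negative `t`). -/
def stateProb (μ : Measure Ω) (X : ℝ≥0 → Ω → ℕ) (n : ℕ) (t : ℝ) : ℝ :=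
  μ.real {ω | X t.toNNReal ω = n}

/-- `X` is a fractional nonlinear birth process with fractionality parameter `ν` and birth rates
`r 1, r 2, …`, started from one progenitor: a counting process with unit jumps whose state
probabilities are locally absolutely continuous and solve
`d^ν p_n / dt^ν = - r n * p_n + r (n - 1) * p_{n-1}`, `n ≥ 1`, with the Caputo derivative
(which, for absolutely continuous functions, exists almost everywhere).
The conditions `p_n(0) = δ_{n,1}` and `p_0 = 0` hold because `X` starts in `1` and is monotone. -/
structure IsFractionalBirthProcess (μ : Measure Ω) (ν : ℝ) (r : ℕ → ℝ) (X : ℝ≥0 → Ω → ℕ) :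
    Prop where
  measurable : ∀ t, Measurable (X t)
  start : ∀ ω, X 0 ω = 1
  monotone : ∀ ω, Monotone fun t => X t ω
  rightCont : ∀ ω t, ContinuousWithinAt (fun s => X s ω) (Set.Ici t) t
  unitJumps : ∀ ω t, 0 < t → ∃ s < t, X t ω ≤ X s ω + 1
  absCont : ∀ n, 1 ≤ n → ∀ T : ℝ, 0 < T →
    AbsolutelyContinuousOnInterval (stateProb μ X n) 0 T
  governing : ∀ n, 1 ≤ n → ∀ᵐ t ∂(volume.restrict (Set.Ioi (0 : ℝ))),
    caputoDeriv ν (stateProb μ X n) t =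
      - r n * stateProb μ X n t + r (n - 1) * stateProb μ X (n - 1) t

/-- The generalized nonlinear Yule model. Webpages form a Yule process (linear birth process) of
rate `β` started from one webpage, given through its holding times: `W i` is the time
spent with exactly `i + 1` webpages, so the `W i` are independent and exponential with rates
`β * (i + 1)`. The webpages are numbered `0, 1, 2, …` in order of creation, and `M k s` is the
number of in-links of webpage `k` when its age is `s`. All holding times and all in-link processes
are mutually independent. -/
structure IsGeneralizedYuleModel (μ : Measure Ω) (β ν : ℝ) (r : ℕ → ℝ)
    (W : ℕ → Ω → ℝ) (M : ℕ → ℝ≥0 → Ω → ℕ) : Prop where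
  measurable_holding : ∀ i, Measurable (W i)
  law_holding : ∀ i : ℕ, HasLaw (W i) (expMeasure (β * (i + 1))) μ
  birth : ∀ k, IsFractionalBirthProcess μ ν r (M k)
  indep : iIndep (componentSigma W M) μ

open Classical in
/-- `K` is a webpage chosen uniformly at random among those present at time `t`: given the
network, `K` equals each of the webpages present with the same probability. -/
structure IsUniformPage (μ : Measure Ω) (W : ℕ → Ω → ℝ) (M : ℕ → ℝ≥0 → Ω → ℕ) (t : ℝ≥0)
    (K : Ω → ℕ) : Prop where
  measurable : Measurable K
  uniform : ∀ k, μ⟦K ⁻¹' {k} | networkSigma W M⟧ =ᵐ[μ]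
    fun ω => if k ∈ pagesAt W t ω then ((pagesAt W t ω).ncard : ℝ)⁻¹ else 0

end Model

/-- The saturating birth rates `λ_j = λ (N - j)` for `j ≤ N`; the subtraction is truncated, so the
rates vanish from the absorbing state `N` on. -/
def saturatingRate (lam : ℝ) (N : ℕ) (j : ℕ) : ℝ := lam * ((N - j : ℕ) : ℝ)

end FracYule

end

/-!
Given the webpage process, the law of the size of the chosen webpage is the average, over the
webpages present, of the state probability of the birth process at the age of the webpage. The
creation times of a Yule process satisfy `T_k = log k / β + c + o(1)` almost surely, because
`T_k` minus its mean is a sum of independent centred variables with summable variances. Hence the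
ages at time `t` of the pages numbered `⌊u m⌋`, where `m` is the number of pages, tend to
`-log u / β`, and for `u` uniform on `(0, 1)` this is an exponential variable of rate `β`. The
limit is therefore the law of the birth process at an independent exponential age, that is,
`β` times the Laplace transform of the state probabilities at `β`. Fractional integration of order
`ν` multiplies that quantity by `β ^ (-ν)`, so the governing equations become a two-term recursion
whose solution is a product. For saturating rates, the partial fraction expansion of the product,
i.e. the iterated forward difference of `x ↦ x⁻¹`, is the alternating sum.
-/

noncomputable section

namespace FracYule

/-! ### Riemann–Liouville integrals -/

section FractionalCalculus

variable {a b ν t z : ℝ}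

/-- The Riemann–Liouville fractional integral of order `a` with base point `0`; it inverts the
Caputo derivative up to the initial value. -/
def fracIntegral (a : ℝ) (g : ℝ → ℝ) (t : ℝ) : ℝ :=
  (Real.Gamma a)⁻¹ * ∫ s in (0 : ℝ)..t, (t - s) ^ (a - 1) * g s

theorem integral_rpow_mul_sub_rpow (ha : 0 < a) (hb : 0 < b) (ht : 0 < t) :
    ∫ x in (0 : ℝ)..t, x ^ (a - 1) * (t - x) ^ (b - 1) = beta a b * t ^ (a + b - 1) := by
  have hscaled := Complex.betaIntegral_scaled a b ht
  have hbeta : Complex.betaIntegral a b = (beta a b : ℂ) := by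
    rw [Complex.betaIntegral_eq_Gamma_mul_div _ _ (by simpa using ha) (by simpa using hb), beta]
    simp only [← Complex.ofReal_add, Complex.Gamma_ofReal, Complex.ofReal_div, Complex.ofReal_mul]
  have hpow : (t : ℂ) ^ ((a : ℂ) + b - 1) = ((t ^ (a + b - 1) : ℝ) : ℂ) := by
    rw [Complex.ofReal_cpow ht.le]
    push_cast
    rfl
  have hreal : ∫ x in (0 : ℝ)..t, (x : ℂ) ^ ((a : ℂ) - 1) * ((t : ℂ) - x) ^ ((b : ℂ) - 1) =
      ((∫ x in (0 : ℝ)..t, x ^ (a - 1) * (t - x) ^ (b - 1) : ℝ) : ℂ) := by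
    rw [← intervalIntegral.integral_ofReal]
    refine intervalIntegral.integral_congr fun x hx => ?_
    rw [Set.uIcc_of_le ht.le] at hx
    simp only [Complex.ofReal_mul, Complex.ofReal_cpow hx.1,
      Complex.ofReal_cpow (sub_nonneg.2 hx.2), Complex.ofReal_sub, Complex.ofReal_one]
  rw [hbeta, hpow, hreal, ← Complex.ofReal_mul] at hscaled
  rw [Complex.ofReal_injective hscaled, mul_comm]

theorem integral_sub_rpow_mul_sub_rpow {u : ℝ} (ha : 0 < a) (hb : 0 < b) (hut : u < t) :
    ∫ s in u..t, (t - s) ^ (a - 1) * (s - u) ^ (b - 1) = beta a b * (t - u) ^ (a + b - 1) := by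
  rw [← integral_rpow_mul_sub_rpow ha hb (sub_pos.2 hut)]
  have hsubst := intervalIntegral.integral_comp_sub_left (a := u) (b := t)
    (fun x => x ^ (a - 1) * (t - u - x) ^ (b - 1)) t
  rw [sub_self] at hsubst
  rw [← hsubst]
  exact intervalIntegral.integral_congr fun s _ => by ring_nf

theorem integral_integral_triangle_swap {E : Type*} [NormedAddCommGroup E] [NormedSpace ℝ E]
    (hab : a ≤ b) {F : ℝ → ℝ → E}
    (hF : IntegrableOn (Function.uncurry F) {p | p.2 < p.1}
      ((volume.restrict (Set.Ioc a b)).prod (volume.restrict (Set.Ioc a b)))) :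
    ∫ s in a..b, ∫ u in a..s, F s u = ∫ u in a..b, ∫ s in u..b, F s u := by
  have hmeas : MeasurableSet {p : ℝ × ℝ | p.2 < p.1} :=
    measurableSet_lt measurable_snd measurable_fst
  have hswap := integral_integral_swap (f := fun s u =>
    Set.indicator {p : ℝ × ℝ | p.2 < p.1} (Function.uncurry F) (s, u))
    (hF.integrable_indicator hmeas)
  rw [intervalIntegral.integral_of_le hab, intervalIntegral.integral_of_le hab]
  convert hswap using 1
  · refine setIntegral_congr_fun measurableSet_Ioc fun s hs => ?_
    change ∫ u in a..s, F s u = ∫ u in Set.Ioc a b, Set.indicator (Set.Iio s) (F s) u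
    rw [intervalIntegral.integral_of_le hs.1.le, integral_Ioc_eq_integral_Ioo,
      setIntegral_indicator measurableSet_Iio]
    congr 2
    grind
  · refine setIntegral_congr_fun measurableSet_Ioc fun u hu => ?_
    change ∫ s in u..b, F s u = ∫ s in Set.Ioc a b, Set.indicator (Set.Ioi u) (fun s => F s u) s
    rw [intervalIntegral.integral_of_le hu.2, setIntegral_indicator measurableSet_Ioi]
    congr 2
    grind

theorem integrableOn_sub_rpow_mul_sub_rpow {u : ℝ} (ha : 0 < a) (hb : 0 < b) (hut : u < t) :
    IntegrableOn (fun s => (t - s) ^ (a - 1) * (s - u) ^ (b - 1)) (Set.Ioc u t) := by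
  refine Integrable.of_integral_ne_zero ?_
  rw [← intervalIntegral.integral_of_le hut.le, integral_sub_rpow_mul_sub_rpow ha hb hut]
  exact (mul_pos (beta_pos ha hb) (Real.rpow_pos_of_pos (sub_pos.2 hut) _)).ne'

theorem setIntegral_norm_sub_rpow_mul_sub_rpow_mul {u : ℝ} (ha : 0 < a) (hb : 0 < b) (hut : u < t)
    (c : ℝ) :
    ∫ s in Set.Ioc u t, ‖(t - s) ^ (a - 1) * (s - u) ^ (b - 1) * c‖ =
      beta a b * ‖(t - u) ^ (a + b - 1) * c‖ := by
  rw [norm_mul, Real.norm_of_nonneg (Real.rpow_nonneg (sub_nonneg.2 hut.le) _), ← mul_assoc,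
    ← integral_sub_rpow_mul_sub_rpow ha hb hut, intervalIntegral.integral_of_le hut.le,
    ← integral_mul_const]
  refine setIntegral_congr_fun measurableSet_Ioc fun s hs => ?_
  rw [norm_mul, Real.norm_of_nonneg (mul_nonneg (Real.rpow_nonneg (sub_nonneg.2 hs.2) _)
    (Real.rpow_nonneg (sub_nonneg.2 hs.1.le) _))]

theorem aestronglyMeasurable_of_sub_rpow_mul {c : ℝ} {g : ℝ → ℝ}
    (hg : AEStronglyMeasurable (fun u => (t - u) ^ c * g u) (volume.restrict (Set.Ioc 0 t))) :
    AEStronglyMeasurable g (volume.restrict (Set.Ioc 0 t)) := by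
  have hinv : Measurable fun u : ℝ => ((t - u) ^ c)⁻¹ := by fun_prop
  refine (hinv.aestronglyMeasurable.mul hg).congr ?_
  rw [Measure.restrict_congr_set Ioo_ae_eq_Ioc.symm]
  filter_upwards [ae_restrict_mem measurableSet_Ioo] with u hu
  exact inv_mul_cancel_left₀ (Real.rpow_pos_of_pos (sub_pos.2 hu.2) c).ne' (g u)

theorem integrableOn_triangle_sub_rpow_mul (ha : 0 < a) (hb : 0 < b) {g : ℝ → ℝ}
    (hg : IntegrableOn (fun u => (t - u) ^ (a + b - 1) * g u) (Set.Ioc 0 t)) :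
    IntegrableOn (Function.uncurry fun s u => (t - s) ^ (a - 1) * (s - u) ^ (b - 1) * g u)
      {p | p.2 < p.1} ((volume.restrict (Set.Ioc 0 t)).prod (volume.restrict (Set.Ioc 0 t))) := by
  have hT : MeasurableSet {p : ℝ × ℝ | p.2 < p.1} := measurableSet_lt measurable_snd measurable_fst
  have hIoo : volume.restrict (Set.Ioc (0 : ℝ) t) = volume.restrict (Set.Ioo 0 t) :=
    Measure.restrict_congr_set Ioo_ae_eq_Ioc.symm
  have hIoc : ∀ u ∈ Set.Ioo 0 t, Set.Ioi u ∩ Set.Ioc 0 t = Set.Ioc u t := by grind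
  have hmeas : AEStronglyMeasurable
      (Function.uncurry fun s u => (t - s) ^ (a - 1) * (s - u) ^ (b - 1) * g u)
      ((volume.restrict (Set.Ioc 0 t)).prod (volume.restrict (Set.Ioc 0 t))) := by
    have hk : Measurable fun p : ℝ × ℝ => (t - p.1) ^ (a - 1) * (p.1 - p.2) ^ (b - 1) := by fun_prop
    exact hk.aestronglyMeasurable.mul
      (aestronglyMeasurable_of_sub_rpow_mul hg.aestronglyMeasurable).comp_snd
  rw [← integrable_indicator_iff hT, integrable_prod_iff' (hmeas.indicator hT)]
  constructor
  · rw [hIoo]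
    filter_upwards [ae_restrict_mem measurableSet_Ioo] with u hu
    change Integrable (Set.indicator (Set.Ioi u)
      fun s => (t - s) ^ (a - 1) * (s - u) ^ (b - 1) * g u) _
    rw [← hIoo, integrable_indicator_iff measurableSet_Ioi, IntegrableOn,
      Measure.restrict_restrict measurableSet_Ioi, hIoc u hu]
    exact (integrableOn_sub_rpow_mul_sub_rpow ha hb hu.2).mul_const (g u)
  · refine (hg.norm.const_mul (beta a b)).congr ?_
    rw [hIoo]
    filter_upwards [ae_restrict_mem measurableSet_Ioo] with u hu
    change _ = ∫ s in Set.Ioo 0 t, ‖Set.indicator (Set.Ioi u)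
      (fun s => (t - s) ^ (a - 1) * (s - u) ^ (b - 1) * g u) s‖
    simp_rw [norm_indicator_eq_indicator_norm]
    rw [← hIoo, integral_indicator measurableSet_Ioi,
      Measure.restrict_restrict measurableSet_Ioi, hIoc u hu,
      setIntegral_norm_sub_rpow_mul_sub_rpow_mul ha hb hu.2]

theorem fracIntegral_fracIntegral (ha : 0 < a) (hb : 0 < b) (ht : 0 ≤ t) {g : ℝ → ℝ}
    (hg : IntegrableOn (fun u => (t - u) ^ (a + b - 1) * g u) (Set.Ioc 0 t)) :
    fracIntegral a (fracIntegral b g) t = fracIntegral (a + b) g t := by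
  have hinner : ∀ s, (t - s) ^ (a - 1) * fracIntegral b g s =
      (Real.Gamma b)⁻¹ * ∫ u in (0 : ℝ)..s, (t - s) ^ (a - 1) * (s - u) ^ (b - 1) * g u := by
    intro s
    simp only [fracIntegral, mul_assoc, intervalIntegral.integral_const_mul]
    ring
  have houter : ∀ u ∈ Set.Ioo 0 t, ∫ s in u..t, (t - s) ^ (a - 1) * (s - u) ^ (b - 1) * g u =
      beta a b * ((t - u) ^ (a + b - 1) * g u) := fun u hu => by
    rw [intervalIntegral.integral_mul_const, integral_sub_rpow_mul_sub_rpow ha hb hu.2, mul_assoc]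
  have hGa := (Real.Gamma_pos_of_pos ha).ne'
  have hGb := (Real.Gamma_pos_of_pos hb).ne'
  rw [fracIntegral, funext hinner, intervalIntegral.integral_const_mul,
    integral_integral_triangle_swap ht (integrableOn_triangle_sub_rpow_mul ha hb hg),
    intervalIntegral.integral_of_le ht, integral_Ioc_eq_integral_Ioo,
    setIntegral_congr_fun measurableSet_Ioo houter, integral_const_mul,
    ← integral_Ioc_eq_integral_Ioo, ← intervalIntegral.integral_of_le ht, fracIntegral, beta]
  field_simp

theorem fracIntegral_one (g : ℝ → ℝ) (t : ℝ) : fracIntegral 1 g t = ∫ s in (0 : ℝ)..t, g s := by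
  simp [fracIntegral]

theorem caputoDeriv_eq_fracIntegral_deriv (hν : ν ≠ 1) (f : ℝ → ℝ) :
    caputoDeriv ν f = fracIntegral (1 - ν) (deriv f) := by
  ext t
  rw [caputoDeriv, if_neg hν, fracIntegral, sub_sub_cancel_left]

theorem fracIntegral_caputoDeriv (h0 : 0 < ν) (h1 : ν ≤ 1) (ht : 0 ≤ t) {f : ℝ → ℝ}
    (hf : AbsolutelyContinuousOnInterval f 0 t) :
    fracIntegral ν (caputoDeriv ν f) t = f t - f 0 := by
  rw [← hf.integral_deriv_eq_sub, ← fracIntegral_one]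
  rcases h1.eq_or_lt with rfl | h1
  · congr 1
    ext s
    exact if_pos rfl
  · have hderiv := hf.intervalIntegrable_deriv
    rw [intervalIntegrable_iff_integrableOn_Ioc_of_le ht] at hderiv
    rw [caputoDeriv_eq_fracIntegral_deriv h1.ne,
      fracIntegral_fracIntegral h0 (sub_pos.2 h1) ht (by simpa using hderiv), add_sub_cancel]

theorem fracIntegral_congr_ae {g h : ℝ → ℝ} (ht : 0 ≤ t)
    (hgh : ∀ᵐ s ∂volume.restrict (Set.Ioi 0), g s = h s) :
    fracIntegral a g t = fracIntegral a h t := by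
  rw [fracIntegral, fracIntegral, intervalIntegral.integral_of_le ht,
    intervalIntegral.integral_of_le ht]
  congr 1
  refine integral_congr_ae ?_
  filter_upwards [ae_restrict_of_ae_restrict_of_subset Set.Ioc_subset_Ioi_self hgh] with s hs
  rw [hs]

theorem fracIntegral_const_mul (c : ℝ) (g : ℝ → ℝ) :
    fracIntegral a (fun s => c * g s) t = c * fracIntegral a g t := by
  simp only [fracIntegral, mul_left_comm _ c, intervalIntegral.integral_const_mul]

theorem integrableOn_rpow_mul_exp_neg_mul (ha : 0 < a) (hz : 0 < z) :
    IntegrableOn (fun x : ℝ => x ^ (a - 1) * Real.exp (-(z * x))) (Set.Ioi 0) := by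
  refine Integrable.of_integral_ne_zero ?_
  rw [Real.integral_rpow_mul_exp_neg_mul_Ioi ha hz]
  have := Real.Gamma_pos_of_pos ha
  positivity

theorem fracIntegral_exp_le (ha : 0 < a) (hz : 0 < z) (ht : 0 ≤ t) :
    fracIntegral a (fun s => Real.exp (z * s)) t ≤ (1 / z) ^ a * Real.exp (z * t) := by
  have hsubst := intervalIntegral.integral_comp_sub_left (a := 0) (b := t)
    (fun x => x ^ (a - 1) * Real.exp (z * (t - x))) t
  simp only [sub_sub_cancel, sub_self, sub_zero] at hsubst
  have hexp : ∀ x : ℝ, x ^ (a - 1) * Real.exp (z * (t - x)) =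
      Real.exp (z * t) * (x ^ (a - 1) * Real.exp (-(z * x))) := fun x => by
    rw [mul_sub, sub_eq_add_neg (z * t), Real.exp_add]
    ring
  have hle : ∫ x in (0 : ℝ)..t, x ^ (a - 1) * Real.exp (-(z * x)) ≤
      (1 / z) ^ a * Real.Gamma a := by
    rw [← Real.integral_rpow_mul_exp_neg_mul_Ioi ha hz, intervalIntegral.integral_of_le ht]
    refine setIntegral_mono_set (integrableOn_rpow_mul_exp_neg_mul ha hz) ?_
      Set.Ioc_subset_Ioi_self.eventuallyLE
    filter_upwards [ae_restrict_mem measurableSet_Ioi] with x hx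
    exact mul_nonneg (Real.rpow_nonneg (le_of_lt hx) _) (Real.exp_pos _).le
  have hΓ := Real.Gamma_pos_of_pos ha
  rw [fracIntegral, hsubst, funext hexp, intervalIntegral.integral_const_mul,
    inv_mul_le_iff₀ hΓ]
  calc Real.exp (z * t) * ∫ x in (0 : ℝ)..t, x ^ (a - 1) * Real.exp (-(z * x))
      ≤ Real.exp (z * t) * ((1 / z) ^ a * Real.Gamma a) := by gcongr
    _ = Real.Gamma a * ((1 / z) ^ a * Real.exp (z * t)) := by ring

theorem intervalIntegrable_sub_rpow_mul (ha : 0 < a) {g : ℝ → ℝ} (hg : Continuous g) :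
    IntervalIntegrable (fun s => (t - s) ^ (a - 1) * g s) volume 0 t := by
  have := (intervalIntegral.intervalIntegrable_rpow' (r := a - 1) (a := t) (b := 0)
    (by linarith)).comp_sub_left t
  rw [sub_self, sub_zero] at this
  exact this.mul_continuousOn hg.continuousOn

theorem fracIntegral_sub (ha : 0 < a) {g h : ℝ → ℝ} (hg : Continuous g) (hh : Continuous h) :
    fracIntegral a (fun s => g s - h s) t = fracIntegral a g t - fracIntegral a h t := by
  simp only [fracIntegral, mul_sub]
  rw [intervalIntegral.integral_sub (intervalIntegrable_sub_rpow_mul ha hg)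
    (intervalIntegrable_sub_rpow_mul ha hh), mul_sub]

theorem abs_fracIntegral_le (ha : 0 < a) (ht : 0 ≤ t) {g G : ℝ → ℝ} (hG : Continuous G)
    (hg : ∀ s, 0 < s → |g s| ≤ G s) : |fracIntegral a g t| ≤ fracIntegral a G t := by
  have hΓ := Real.Gamma_pos_of_pos ha
  rw [fracIntegral, abs_mul, abs_of_pos (inv_pos.2 hΓ), fracIntegral, ← Real.norm_eq_abs]
  refine mul_le_mul_of_nonneg_left ?_ (inv_pos.2 hΓ).le
  refine intervalIntegral.norm_integral_le_of_norm_le ht (ae_of_all _ fun s hs => ?_)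
    (intervalIntegrable_sub_rpow_mul ha hG)
  have hk : 0 ≤ (t - s) ^ (a - 1) := Real.rpow_nonneg (sub_nonneg.2 hs.2) _
  rw [norm_mul, Real.norm_of_nonneg hk]
  exact mul_le_mul_of_nonneg_left (hg s hs.1) hk

/-- `fracIntegral a` contracts the norm `sup |q t| exp (-z t)` by the factor `z ^ (-a)`, so that
`c • fracIntegral a` is a contraction for large `z`. -/
theorem eq_zero_of_eq_const_mul_fracIntegral (ha : 0 < a) {c C : ℝ} {q : ℝ → ℝ}
    (hbound : ∀ t, |q t| ≤ C) (hq : ∀ t, 0 < t → q t = c * fracIntegral a q t) (ht : 0 < t) :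
    q t = 0 := by
  obtain ⟨z, hz, hcz⟩ : ∃ z > 0, |c| * (1 / z) ^ a ≤ 1 / 2 := by
    refine ⟨(2 * |c| + 1) ^ (1 / a), by positivity, ?_⟩
    rw [Real.div_rpow zero_le_one (by positivity), Real.one_rpow, ← Real.rpow_mul (by positivity),
      one_div_mul_cancel ha.ne', Real.rpow_one, mul_one_div, div_le_div_iff₀ (by positivity)
      two_pos]
    linarith
  let S := ⨆ t : Set.Ioi (0 : ℝ), |q t| * Real.exp (-(z * t))
  have hbdd : BddAbove (Set.range fun t : Set.Ioi (0 : ℝ) => |q t| * Real.exp (-(z * t))) := by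
    refine ⟨C, Set.forall_mem_range.2 fun t => ?_⟩
    have ht : 0 < (t : ℝ) := t.2
    exact (mul_le_of_le_one_right (abs_nonneg _) (Real.exp_le_one_iff.2
      (neg_nonpos.2 (by positivity)))).trans (hbound t)
  have hle : ∀ s, 0 < s → |q s| ≤ S * Real.exp (z * s) := fun s hs => by
    have := le_ciSup hbdd ⟨s, hs⟩
    rwa [Real.exp_neg, ← div_eq_mul_inv, div_le_iff₀ (Real.exp_pos _)] at this
  have hS : 0 ≤ S := Real.iSup_nonneg fun t => by positivity
  have hhalf : ∀ s, 0 < s → |q s| ≤ (S / 2) * Real.exp (z * s) := fun s hs => by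
    rw [hq s hs, abs_mul]
    calc |c| * |fracIntegral a q s|
        ≤ |c| * (S * ((1 / z) ^ a * Real.exp (z * s))) := by
          gcongr
          refine (abs_fracIntegral_le ha hs.le (by fun_prop) hle).trans ?_
          rw [fracIntegral_const_mul]
          exact mul_le_mul_of_nonneg_left (fracIntegral_exp_le ha hz hs.le) hS
      _ = (|c| * (1 / z) ^ a) * (S * Real.exp (z * s)) := by ring
      _ ≤ 1 / 2 * (S * Real.exp (z * s)) := by gcongr
      _ = (S / 2) * Real.exp (z * s) := by ring
  have hS2 : S ≤ S / 2 := ciSup_le fun t => by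
    rw [Real.exp_neg, ← div_eq_mul_inv, div_le_iff₀ (Real.exp_pos _)]
    exact hhalf t t.2
  have := hle t ht
  rw [show S = 0 by linarith, zero_mul] at this
  exact abs_nonpos_iff.1 this

end FractionalCalculus

/-! ### Exponential distributions and the Laplace transform -/

section Exponential

variable {r : ℝ}

theorem expMeasure_eq_withDensity (r : ℝ) :
    expMeasure r = (volume.restrict (Set.Ioi 0)).withDensity
      fun x => ENNReal.ofReal (r * Real.exp (-(r * x))) := by
  rw [← withDensity_indicator measurableSet_Ioi]
  change volume.withDensity (exponentialPDF r) = _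
  refine withDensity_congr_ae ?_
  filter_upwards [Measure.ae_ne volume (0 : ℝ)] with x hx
  rcases hx.lt_or_gt with hx | hx
  · rw [exponentialPDF_of_neg hx, Set.indicator_of_notMem (by simpa using hx.le)]
  · rw [exponentialPDF_of_nonneg hx.le, Set.indicator_of_mem (Set.mem_Ioi.2 hx)]

theorem integral_expMeasure (hr : 0 < r) (g : ℝ → ℝ) :
    ∫ x, g x ∂expMeasure r = ∫ x in Set.Ioi 0, r * (Real.exp (-(r * x)) * g x) := by
  rw [expMeasure_eq_withDensity, integral_withDensity_eq_integral_toReal_smul (by fun_prop)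
    (ae_of_all _ fun x => ENNReal.ofReal_lt_top)]
  congr 1
  ext x
  rw [ENNReal.toReal_ofReal (by positivity), smul_eq_mul, mul_assoc]

theorem integrable_expMeasure_iff (hr : 0 < r) {g : ℝ → ℝ} :
    Integrable g (expMeasure r) ↔
      IntegrableOn (fun x => Real.exp (-(r * x)) * g x) (Set.Ioi 0) := by
  rw [expMeasure_eq_withDensity, integrable_withDensity_iff_integrable_smul' (by fun_prop)
    (ae_of_all _ fun x => ENNReal.ofReal_lt_top)]
  refine .trans (integrable_congr (ae_of_all _ fun x => ?_))
    (integrable_const_mul_iff hr.ne'.isUnit _)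
  simp only
  rw [ENNReal.toReal_ofReal (by positivity), smul_eq_mul, mul_assoc]

theorem ae_pos_expMeasure (r : ℝ) : ∀ᵐ x ∂expMeasure r, 0 < x := by
  rw [expMeasure_eq_withDensity]
  exact (withDensity_absolutelyContinuous _ _).ae_le (ae_restrict_mem measurableSet_Ioi)

theorem integral_rpow_expMeasure {a : ℝ} (ha : 0 < a) (hr : 0 < r) :
    ∫ x, x ^ (a - 1) ∂expMeasure r = r * ((1 / r) ^ a * Real.Gamma a) := by
  rw [integral_expMeasure hr, integral_const_mul, ← Real.integral_rpow_mul_exp_neg_mul_Ioi ha hr]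
  simp only [mul_comm]

theorem integral_id_expMeasure (hr : 0 < r) : ∫ x, x ∂expMeasure r = 1 / r := by
  have h := integral_rpow_expMeasure two_pos hr
  norm_num at h
  rw [h]
  field_simp

theorem integral_sq_expMeasure (hr : 0 < r) : ∫ x, x ^ 2 ∂expMeasure r = 2 / r ^ 2 := by
  have h := integral_rpow_expMeasure three_pos hr
  have hΓ : Real.Gamma 3 = 2 := by
    rw [show (3 : ℝ) = (2 : ℕ) + 1 by norm_num, Real.Gamma_nat_eq_factorial]
    norm_num
  norm_num [hΓ] at h
  rw [h]
  field_simp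

theorem integral_fracIntegral_expMeasure {a z : ℝ} (ha : 0 < a) (hz : 0 < z) {h : ℝ → ℝ}
    (hh : Integrable h (expMeasure z)) :
    ∫ t, fracIntegral a h t ∂expMeasure z = (1 / z) ^ a * ∫ t, h t ∂expMeasure z := by
  have hconv := integral_posConvolution ((integrable_expMeasure_iff hz).1 hh)
    (integrableOn_rpow_mul_exp_neg_mul ha hz) (ContinuousLinearMap.mul ℝ ℝ)
  have hintegrand : ∀ t, ∫ s in (0 : ℝ)..t, ContinuousLinearMap.mul ℝ ℝ (Real.exp (-(z * s)) * h s)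
      ((t - s) ^ (a - 1) * Real.exp (-(z * (t - s)))) =
      Real.Gamma a * (Real.exp (-(z * t)) * fracIntegral a h t) := fun t => by
    rw [fracIntegral, mul_left_comm, mul_inv_cancel_left₀ (Real.Gamma_pos_of_pos ha).ne',
      ← intervalIntegral.integral_const_mul]
    refine intervalIntegral.integral_congr fun s _ => ?_
    have : Real.exp (-(z * t)) = Real.exp (-(z * s)) * Real.exp (-(z * (t - s))) := by
      rw [← Real.exp_add]
      ring_nf
    simp only [this, ContinuousLinearMap.mul_apply']
    ring
  simp only [hintegrand, integral_const_mul] at hconv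
  rw [ContinuousLinearMap.mul_apply', Real.integral_rpow_mul_exp_neg_mul_Ioi ha hz] at hconv
  have hΓ := (Real.Gamma_pos_of_pos ha).ne'
  rw [integral_expMeasure hz, integral_expMeasure hz, integral_const_mul, integral_const_mul]
  refine mul_left_cancel₀ hΓ ?_
  linear_combination z * hconv

end Exponential

/-! ### State probabilities of a fractional birth process -/

theorem tendsto_floor_mul_add_one_div (t : ℝ≥0) :
    Tendsto (fun n : ℕ => ((⌊t * (n + 1)⌋₊ : ℝ≥0) + 1) / (n + 1)) atTop (𝓝[≥] t) := by
  have hge : ∀ n : ℕ, t ≤ ((⌊t * (n + 1)⌋₊ : ℝ≥0) + 1) / (n + 1) := fun n => by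
    rw [le_div_iff₀ (by positivity)]
    exact (Nat.lt_floor_add_one _).le
  have hle : ∀ n : ℕ, ((⌊t * (n + 1)⌋₊ : ℝ≥0) + 1) / (n + 1) ≤ t + 1 / ((n : ℝ≥0) + 1) :=
    fun n => by
      rw [div_le_iff₀ (by positivity), add_mul, one_div, inv_mul_cancel₀ (by positivity)]
      gcongr
      exact Nat.floor_le zero_le
  refine tendsto_nhdsWithin_iff.2 ⟨?_, .of_forall hge⟩
  refine tendsto_of_tendsto_of_tendsto_of_le_of_le tendsto_const_nhds ?_ hge hle
  simpa using (tendsto_one_div_add_atTop_nhds_zero_nat (𝕜 := ℝ≥0)).const_add t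

theorem measurable_uncurry_of_continuousWithinAt_Ici {Ω E : Type*} {m : MeasurableSpace Ω}
    [TopologicalSpace E] [TopologicalSpace.PseudoMetrizableSpace E] [MeasurableSpace E]
    [BorelSpace E] {X : ℝ≥0 → Ω → E} (hmeas : ∀ t, Measurable (X t))
    (hcont : ∀ ω t, ContinuousWithinAt (fun s => X s ω) (Set.Ici t) t) :
    Measurable (Function.uncurry X) := by
  obtain ⟨a, κ, hκ, hlim⟩ : ∃ (a : ℕ → ℕ → ℝ≥0) (κ : ℕ → ℝ≥0 → ℕ), (∀ n, Measurable (κ n)) ∧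
      ∀ t, Tendsto (fun n => a n (κ n t)) atTop (𝓝[≥] t) :=
    ⟨fun n k => (k + 1) / (n + 1), fun n t => ⌊t * (n + 1)⌋₊,
      fun n => Nat.measurable_floor.comp (measurable_id.mul_const _),
      tendsto_floor_mul_add_one_div⟩
  have hstep : ∀ n, Measurable fun q : ℕ × Ω => X (a n q.1) q.2 := fun n =>
    measurable_from_prod_countable_right fun k => hmeas (a n k)
  exact measurable_of_tendsto_metrizable
    (fun n => (hstep n).comp (((hκ n).comp measurable_fst).prodMk measurable_snd))
    (tendsto_pi_nhds.2 fun p => (hcont p.2 p.1).tendsto.comp (hlim p.1))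

section StateProb

variable {Ω : Type*} [MeasurableSpace Ω] {μ : Measure Ω} {ν z : ℝ} {r : ℕ → ℝ}
  {X Y : ℝ≥0 → Ω → ℕ}

theorem abs_stateProb_le_one [IsProbabilityMeasure μ] (n : ℕ) (t : ℝ) :
    |stateProb μ X n t| ≤ 1 := by
  rw [stateProb, abs_of_nonneg measureReal_nonneg]
  exact measureReal_le_one

namespace IsFractionalBirthProcess

theorem measurable_uncurry (h : IsFractionalBirthProcess μ ν r X) :
    Measurable (Function.uncurry X) :=
  measurable_uncurry_of_continuousWithinAt_Ici h.measurable h.rightCont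

theorem stateProb_zero (h : IsFractionalBirthProcess μ ν r X) : stateProb μ X 0 = 0 := by
  ext t
  have hempty : {ω | X t.toNNReal ω = 0} = ∅ := by
    refine Set.eq_empty_of_forall_notMem fun ω hω => ?_
    have hle : X 0 ω ≤ X t.toNNReal ω := h.monotone ω zero_le
    rw [h.start, hω] at hle
    exact absurd hle (by norm_num)
  rw [stateProb, hempty, measureReal_empty, Pi.zero_apply]

theorem continuous_stateProb (h : IsFractionalBirthProcess μ ν r X) (n : ℕ) :
    Continuous (stateProb μ X n) := by
  rcases Nat.eq_zero_or_pos n with rfl | hn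
  · rw [h.stateProb_zero]
    exact continuous_zero
  have hmax : ∀ t : ℝ, stateProb μ X n (max t 0) = stateProb μ X n t := fun t => by
    simp [stateProb, Real.toNNReal]
  refine continuous_iff_continuousAt.2 fun t => ?_
  have hac := (h.absCont n hn (|t| + 1) (by positivity)).continuousOn
  rw [Set.uIcc_of_le (by positivity)] at hac
  have hcomp : ContinuousOn (fun s => stateProb μ X n (max s 0)) (Set.Iio (|t| + 1)) :=
    hac.comp (by fun_prop) fun s hs => ⟨le_max_right s 0, max_le hs.le (by positivity)⟩
  simp only [hmax] at hcomp
  exact hcomp.continuousAt (Iio_mem_nhds ((le_abs_self t).trans_lt (lt_add_one _)))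

variable [IsProbabilityMeasure μ]

theorem stateProb_of_nonpos (h : IsFractionalBirthProcess μ ν r X) (n : ℕ) {t : ℝ} (ht : t ≤ 0) :
    stateProb μ X n t = if n = 1 then 1 else 0 := by
  simp only [stateProb, Real.toNNReal_of_nonpos ht, h.start]
  split_ifs with hn
  · simp [hn]
  · simp [Ne.symm hn]

theorem stateProb_eq_add_fracIntegral (h : IsFractionalBirthProcess μ ν r X) (h0 : 0 < ν)
    (h1 : ν ≤ 1) {n : ℕ} (hn : 1 ≤ n) {t : ℝ} (ht : 0 < t) :
    stateProb μ X n t = (if n = 1 then 1 else 0) + fracIntegral ν (fun s =>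
      - r n * stateProb μ X n s + r (n - 1) * stateProb μ X (n - 1) s) t := by
  rw [← fracIntegral_congr_ae ht.le (h.governing n hn),
    fracIntegral_caputoDeriv h0 h1 ht.le (h.absCont n hn t ht), h.stateProb_of_nonpos n le_rfl]
  ring

theorem stateProb_unique (hX : IsFractionalBirthProcess μ ν r X)
    (hY : IsFractionalBirthProcess μ ν r Y) (h0 : 0 < ν) (h1 : ν ≤ 1) (n : ℕ) :
    stateProb μ X n = stateProb μ Y n := by
  induction n with
  | zero => rw [hX.stateProb_zero, hY.stateProb_zero]
  | succ n ih =>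
    have hcX := hX.continuous_stateProb
    have hcY := hY.continuous_stateProb
    ext t
    rcases le_or_gt t 0 with ht | ht
    · rw [hX.stateProb_of_nonpos _ ht, hY.stateProb_of_nonpos _ ht]
    refine sub_eq_zero.1 (eq_zero_of_eq_const_mul_fracIntegral h0 (c := -r (n + 1)) (C := 1 + 1)
      (q := fun t => stateProb μ X (n + 1) t - stateProb μ Y (n + 1) t) (fun t => ?_)
      (fun t ht => ?_) ht)
    · exact (abs_sub _ _).trans (add_le_add (abs_stateProb_le_one _ _) (abs_stateProb_le_one _ _))
    · rw [hX.stateProb_eq_add_fracIntegral h0 h1 (by omega) ht,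
        hY.stateProb_eq_add_fracIntegral h0 h1 (by omega) ht, Nat.add_sub_cancel, ← ih,
        add_sub_add_left_eq_sub, ← fracIntegral_sub h0 (by fun_prop) (by fun_prop),
        ← fracIntegral_const_mul]
      congr 1
      ext s
      ring

theorem integrable_stateProb_expMeasure (h : IsFractionalBirthProcess μ ν r X) (hz : 0 < z)
    (n : ℕ) : Integrable (stateProb μ X n) (expMeasure z) :=
  have := isProbabilityMeasure_expMeasure hz
  .of_bound (h.continuous_stateProb n).aestronglyMeasurable 1
    (ae_of_all _ (abs_stateProb_le_one n))

theorem rpow_add_rate_mul_integral_stateProb (h : IsFractionalBirthProcess μ ν r X) (h0 : 0 < ν)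
    (h1 : ν ≤ 1) (hz : 0 < z) {n : ℕ} (hn : 1 ≤ n) :
    (z ^ ν + r n) * ∫ t, stateProb μ X n t ∂expMeasure z =
      z ^ ν * (if n = 1 then 1 else 0) +
        r (n - 1) * ∫ t, stateProb μ X (n - 1) t ∂expMeasure z := by
  have := isProbabilityMeasure_expMeasure hz
  have hint := h.integrable_stateProb_expMeasure hz
  have hflow : Integrable (fun s => - r n * stateProb μ X n s +
      r (n - 1) * stateProb μ X (n - 1) s) (expMeasure z) :=
    ((hint n).const_mul _).add ((hint (n - 1)).const_mul _)
  have hvolterra : ∫ t, stateProb μ X n t ∂expMeasure z - (if n = 1 then 1 else 0) =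
      (1 / z) ^ ν * ∫ s, (- r n * stateProb μ X n s + r (n - 1) * stateProb μ X (n - 1) s)
        ∂expMeasure z := by
    rw [← integral_fracIntegral_expMeasure h0 hz hflow]
    have hconst : ∫ _ : ℝ, (if n = 1 then (1 : ℝ) else 0) ∂expMeasure z =
      if n = 1 then 1 else 0 := by simp
    rw [← hconst, ← integral_sub (hint n) (integrable_const _)]
    refine integral_congr_ae ?_
    filter_upwards [ae_pos_expMeasure z] with t ht
    rw [h.stateProb_eq_add_fracIntegral h0 h1 hn ht, add_sub_cancel_left]
  rw [integral_add ((hint n).const_mul _) ((hint (n - 1)).const_mul _), integral_const_mul,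
    integral_const_mul, Real.div_rpow zero_le_one hz.le, Real.one_rpow] at hvolterra
  have hzν : z ^ ν ≠ 0 := (Real.rpow_pos_of_pos hz ν).ne'
  field_simp at hvolterra
  linear_combination hvolterra

theorem integral_stateProb_expMeasure (h : IsFractionalBirthProcess μ ν r X) (h0 : 0 < ν)
    (h1 : ν ≤ 1) (hr : ∀ n, 0 ≤ r n) (hz : 0 < z) {n : ℕ} (hn : 1 ≤ n) :
    ∫ t, stateProb μ X n t ∂expMeasure z =
      z ^ ν / (z ^ ν + r n) * ∏ m ∈ Finset.Ico 1 n, r m / (z ^ ν + r m) := by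
  have hpos : ∀ m, 0 < z ^ ν + r m := fun m =>
    add_pos_of_pos_of_nonneg (Real.rpow_pos_of_pos hz ν) (hr m)
  induction n, hn using Nat.le_induction with
  | base =>
    have hrec := h.rpow_add_rate_mul_integral_stateProb h0 h1 hz le_rfl
    rw [if_pos rfl, Nat.sub_self, h.stateProb_zero] at hrec
    simp only [Pi.zero_apply, integral_zero, mul_zero, add_zero, mul_one] at hrec
    rw [Finset.Ico_self, Finset.prod_empty, mul_one, eq_div_iff (hpos 1).ne', mul_comm, hrec]
  | succ n hn ih =>
    have hrec := h.rpow_add_rate_mul_integral_stateProb h0 h1 hz (Nat.le_add_left 1 n)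
    rw [if_neg (by omega), Nat.add_sub_cancel, ih, mul_zero, zero_add] at hrec
    rw [Finset.prod_Ico_succ_top hn, ← mul_right_inj' (hpos (n + 1)).ne', hrec]
    have := (hpos n).ne'
    have := (hpos (n + 1)).ne'
    field_simp

end IsFractionalBirthProcess

/-- The law of `X` at an independent exponential age with rate `z`. -/
def exponentialAgeLaw (μ : Measure Ω) (X : ℝ≥0 → Ω → ℕ) (z : ℝ) : Measure ℕ :=
  ((expMeasure z).prod μ).map fun p => X p.1.toNNReal p.2

namespace IsFractionalBirthProcess

theorem measurable_comp_toNNReal (h : IsFractionalBirthProcess μ ν r X) :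
    Measurable fun p : ℝ × Ω => X p.1.toNNReal p.2 :=
  h.measurable_uncurry.comp (by fun_prop : Measurable fun p : ℝ × Ω => (p.1.toNNReal, p.2))

variable [IsProbabilityMeasure μ]

theorem isProbabilityMeasure_exponentialAgeLaw (h : IsFractionalBirthProcess μ ν r X)
    (hz : 0 < z) : IsProbabilityMeasure (exponentialAgeLaw μ X z) :=
  have := isProbabilityMeasure_expMeasure hz
  Measure.isProbabilityMeasure_map h.measurable_comp_toNNReal.aemeasurable

theorem exponentialAgeLaw_real_singleton (h : IsFractionalBirthProcess μ ν r X) (hz : 0 < z)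
    (n : ℕ) :
    (exponentialAgeLaw μ X z).real {n} = ∫ t, stateProb μ X n t ∂expMeasure z := by
  have := isProbabilityMeasure_expMeasure hz
  have hn : MeasurableSet {p : ℝ × Ω | X p.1.toNNReal p.2 = n} :=
    h.measurable_comp_toNNReal (measurableSet_singleton n)
  rw [exponentialAgeLaw, map_measureReal_apply h.measurable_comp_toNNReal
    (measurableSet_singleton n)]
  change (((expMeasure z).prod μ) {p : ℝ × Ω | X p.1.toNNReal p.2 = n}).toReal = _
  rw [Measure.prod_apply hn, ← integral_toReal]
  · rfl
  · exact (measurable_measure_prodMk_left hn).aemeasurable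
  · exact ae_of_all _ fun t => measure_lt_top _ _

end IsFractionalBirthProcess

end StateProb

/-! ### Empirical ages along a deterministic sequence of creation times -/

theorem integral_comp_floor_mul {E : Type*} [NormedAddCommGroup E] [NormedSpace ℝ E]
    [CompleteSpace E] (a : ℕ → E) {n : ℕ} (hn : n ≠ 0) :
    ∫ u in (0 : ℝ)..1, a ⌊u * n⌋₊ = (n : ℝ)⁻¹ • ∑ k ∈ Finset.range n, a k := by
  have hfloor : ∀ k : ℕ, Set.EqOn (fun v : ℝ => a ⌊v⌋₊) (fun _ => a k) (Set.Ioo k (k + 1 : ℕ)) :=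
    fun k v hv => congrArg a (Nat.floor_eq_on_Ico k v (by simpa using Set.Ioo_subset_Ico_self hv))
  have hstep : ∀ k : ℕ, ∫ v in (k : ℝ)..(k + 1 : ℕ), a ⌊v⌋₊ = a k := fun k => by
    rw [intervalIntegral.integral_congr_Ioo_of_le (by simp) (hfloor k),
      intervalIntegral.integral_const, Nat.cast_succ, add_sub_cancel_left, one_smul]
  have hint : ∀ k < n, IntervalIntegrable (fun v : ℝ => a ⌊v⌋₊) volume k (k + 1 : ℕ) :=
    fun k _ => (intervalIntegrable_const (c := a k)).congr_uIoo
      (by rw [Set.uIoo_of_le (by simp)]; exact (hfloor k).symm)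
  rw [intervalIntegral.integral_comp_mul_right (fun v : ℝ => a ⌊v⌋₊) (Nat.cast_ne_zero.2 hn),
    zero_mul, one_mul, ← Nat.cast_zero,
    ← intervalIntegral.sum_integral_adjacent_intervals (a := fun k : ℕ => (k : ℝ)) hint]
  simp only [hstep]

theorem integral_comp_neg_log_div {β : ℝ} (hβ : 0 < β) (g : ℝ → ℝ) :
    ∫ u in (0 : ℝ)..1, g (-Real.log u / β) = ∫ s, g s ∂expMeasure β := by
  have himg : (fun s : ℝ => Real.exp (-(β * s))) '' Set.Ioi 0 = Set.Ioo 0 1 := by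
    refine Set.Subset.antisymm ?_ fun u hu => ?_
    · rintro _ ⟨s, hs, rfl⟩
      exact ⟨Real.exp_pos _, Real.exp_lt_one_iff.2 (neg_lt_zero.2 (mul_pos hβ hs))⟩
    · refine ⟨-Real.log u / β, div_pos (neg_pos.2 (Real.log_neg hu.1 hu.2)) hβ, ?_⟩
      simp only [mul_div_cancel₀ _ hβ.ne', neg_neg, Real.exp_log hu.1]
  have hderiv : ∀ s ∈ Set.Ioi (0 : ℝ), HasDerivWithinAt (fun s : ℝ => Real.exp (-(β * s)))
      (Real.exp (-(β * s)) * -(β * 1)) (Set.Ioi 0) s := fun s _ =>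
    ((hasDerivAt_id s).const_mul β).neg.exp.hasDerivWithinAt
  have hinj : Set.InjOn (fun s : ℝ => Real.exp (-(β * s))) (Set.Ioi 0) := fun s _ s' _ h =>
    mul_left_cancel₀ hβ.ne' (neg_injective (Real.exp_injective h))
  rw [integral_expMeasure hβ, intervalIntegral.integral_of_le zero_le_one,
    integral_Ioc_eq_integral_Ioo, ← himg,
    integral_image_eq_integral_abs_deriv_smul measurableSet_Ioi hderiv hinj]
  refine setIntegral_congr_fun measurableSet_Ioi fun s _ => ?_
  simp only [Real.log_exp, neg_neg, mul_div_cancel_left₀ s hβ.ne', abs_mul, abs_neg, mul_one,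
    abs_of_pos hβ, abs_of_pos (Real.exp_pos _), smul_eq_mul]
  ring

theorem le_iff_lt_ncard {α : Type*} [LinearOrder α] [NoMaxOrder α] {T : ℕ → α} (hmono : Monotone T)
    (htop : Tendsto T atTop atTop) (t : α) (k : ℕ) : T k ≤ t ↔ k < {j | T j ≤ t}.ncard := by
  classical
  have hex : ∃ j, t < T j := (htop.eventually_gt_atTop t).exists
  have hfind : ∀ j, T j ≤ t ↔ j < Nat.find hex := fun j =>
    ⟨fun hj => lt_of_not_ge fun h => ((Nat.find_spec hex).trans_le (hmono h)).not_ge hj,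
      fun hj => not_lt.1 (Nat.find_min hex hj)⟩
  have hset : {j | T j ≤ t} = Finset.Iio (Nat.find hex) := by
    ext j
    simpa using hfind j
  rw [hset, Set.ncard_coe_finset, Nat.card_Iio]
  exact hfind k

theorem tendsto_ncard_setOf_le {α : Type*} [LinearOrder α] [NoMaxOrder α] {T : ℕ → α}
    (hmono : Monotone T) (htop : Tendsto T atTop atTop) :
    Tendsto (fun t => {k | T k ≤ t}.ncard) atTop atTop :=
  tendsto_atTop.2 fun m => (eventually_ge_atTop (T m)).mono fun t ht =>
    ((le_iff_lt_ncard hmono htop t m).1 ht).le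

section LogarithmicGrowth

variable {T : ℕ → ℝ} {β c : ℝ}

theorem tendsto_floor_mul_sub_log
    (hT : Tendsto (fun k : ℕ => T k - Real.log (k + 1) / β) atTop (𝓝 c)) {u : ℝ} (hu : 0 < u) :
    Tendsto (fun n : ℕ => T ⌊u * n⌋₊ - Real.log n / β) atTop (𝓝 (c + Real.log u / β)) := by
  have hfloor : Tendsto (fun n : ℕ => ⌊u * (n : ℝ)⌋₊) atTop atTop :=
    tendsto_nat_floor_atTop.comp (tendsto_natCast_atTop_atTop.const_mul_atTop hu)
  have hratio : Tendsto (fun n : ℕ => (⌊u * (n : ℝ)⌋₊ + 1 : ℝ) / n) atTop (𝓝 u) := by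
    simpa [add_div] using ((tendsto_nat_floor_mul_div_atTop (R := ℝ) hu.le).comp
      tendsto_natCast_atTop_atTop).add tendsto_one_div_atTop_nhds_zero_nat
  refine ((hT.comp hfloor).add ((hratio.log hu.ne').div_const β)).congr' ?_
  filter_upwards [eventually_ne_atTop 0] with n hn
  rw [Function.comp_apply, Real.log_div (by positivity) (Nat.cast_ne_zero.2 hn)]
  ring

theorem tendsto_atTop_of_tendsto_sub_log (hβ : 0 < β)
    (hT : Tendsto (fun k : ℕ => T k - Real.log (k + 1) / β) atTop (𝓝 c)) :
    Tendsto T atTop atTop := by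
  have hlog : Tendsto (fun k : ℕ => Real.log ((k : ℝ) + 1) / β) atTop atTop :=
    (Real.tendsto_log_atTop.comp
      (tendsto_atTop_add_const_right _ 1 tendsto_natCast_atTop_atTop)).atTop_div_const hβ
  exact (hT.add_atTop hlog).congr fun k => sub_add_cancel _ _

theorem tendsto_sub_log_ncard (hβ : 0 < β) (hmono : Monotone T)
    (hT : Tendsto (fun k : ℕ => T k - Real.log (k + 1) / β) atTop (𝓝 c)) :
    Tendsto (fun t : ℝ => t - Real.log {k | T k ≤ t}.ncard / β) atTop (𝓝 c) := by
  have htop := tendsto_atTop_of_tendsto_sub_log hβ hT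
  have hncard := tendsto_ncard_setOf_le hmono htop
  have hupper : Tendsto (fun m : ℕ => T m - Real.log m / β) atTop (𝓝 c) := by
    simpa using tendsto_floor_mul_sub_log hT one_pos
  have hlower : Tendsto (fun m : ℕ => T (m - 1) - Real.log m / β) atTop (𝓝 c) := by
    refine (hT.comp (tendsto_sub_atTop_nat 1)).congr' ?_
    filter_upwards [eventually_ge_atTop 1] with m hm
    simp [Nat.cast_sub hm]
  refine tendsto_of_tendsto_of_tendsto_of_le_of_le' (hlower.comp hncard) (hupper.comp hncard) ?_
    (.of_forall fun t => ?_)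
  · filter_upwards [hncard.eventually_gt_atTop 0] with t ht
    exact sub_le_sub_right
      ((le_iff_lt_ncard hmono htop t _).2 (Nat.sub_lt ht one_pos)) _
  · exact sub_le_sub_right
      (lt_of_not_ge fun h => lt_irrefl _ ((le_iff_lt_ncard hmono htop t _).1 h)).le _

theorem tendsto_average_ages (hβ : 0 < β) (hmono : Monotone T)
    (hT : Tendsto (fun k : ℕ => T k - Real.log (k + 1) / β) atTop (𝓝 c))
    {g : ℝ → ℝ} (hg : Continuous g) {C : ℝ} (hC : ∀ s, |g s| ≤ C) :
    Tendsto (fun t : ℝ => ({k | T k ≤ t}.ncard : ℝ)⁻¹ *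
        ∑ k ∈ Finset.range {k | T k ≤ t}.ncard, g (t - T k)) atTop
      (𝓝 (∫ s, g s ∂expMeasure β)) := by
  have hncard := tendsto_ncard_setOf_le hmono (tendsto_atTop_of_tendsto_sub_log hβ hT)
  have hage : ∀ u ∈ Set.uIoc (0 : ℝ) 1, Tendsto
      (fun t : ℝ => t - T ⌊u * {k | T k ≤ t}.ncard⌋₊) atTop (𝓝 (-Real.log u / β)) := by
    intro u hu
    rw [Set.uIoc_of_le zero_le_one] at hu
    convert (tendsto_sub_log_ncard hβ hmono hT).sub
      ((tendsto_floor_mul_sub_log hT hu.1).comp hncard) using 2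
    · exact (sub_sub_sub_cancel_right _ _ _).symm
    · ring
  have hmeas : ∀ t : ℝ, Measurable fun u : ℝ => g (t - T ⌊u * {k | T k ≤ t}.ncard⌋₊) := fun t =>
    hg.measurable.comp (measurable_const.sub ((measurable_of_countable T).comp
      (Nat.measurable_floor.comp (measurable_id.mul_const _))))
  rw [← integral_comp_neg_log_div hβ]
  refine (intervalIntegral.tendsto_integral_filter_of_dominated_convergence (fun _ => C)
    (.of_forall fun t => (hmeas t).aestronglyMeasurable)
    (.of_forall fun t => ae_of_all _ fun u _ => hC _) intervalIntegrable_const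
    (ae_of_all _ fun u hu => (hg.tendsto _).comp (hage u hu))).congr' ?_
  filter_upwards [hncard.eventually_ne_atTop 0] with t ht
  exact integral_comp_floor_mul (fun k => g (t - T k)) ht

end LogarithmicGrowth

/-! ### Almost sure growth of the Yule process -/

section IndependentSeries

variable {Ω : Type*} [MeasurableSpace Ω] {μ : Measure Ω} [IsProbabilityMeasure μ]

theorem martingale_sum_range_succ {X : ℕ → Ω → ℝ} (hm : ∀ i, StronglyMeasurable (X i))
    (hint : ∀ i, Integrable (X i) μ) (hind : iIndepFun X μ) (hmean : ∀ i, ∫ ω, X i ω ∂μ = 0) :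
    Martingale (fun n => ∑ i ∈ Finset.range (n + 1), X i) (Filtration.natural X hm) μ := by
  refine martingale_of_condExp_sub_eq_zero_nat (fun n => ?_)
    (fun n => integrable_finsetSum' _ fun i _ => hint i) fun n => ?_
  · exact Finset.stronglyMeasurable_sum _ fun i hi =>
      (Filtration.stronglyAdapted_natural hm i).mono
        ((Filtration.natural X hm).mono (Nat.lt_succ_iff.1 (Finset.mem_range.1 hi)))
  · rw [Finset.sum_range_succ _ (n + 1), add_sub_cancel_left]
    filter_upwards [hind.condExp_natural_ae_eq_of_lt hm n.lt_succ_self] with ω hω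
    rw [hω, hmean, Pi.zero_apply]

theorem eLpNorm_one_le_one_add_variance {X : Ω → ℝ} (hX : MemLp X 2 μ)
    (hmean : ∫ ω, X ω ∂μ = 0) : eLpNorm X 1 μ ≤ ENNReal.ofReal (1 + Var[X; μ]) := by
  have hint : Integrable X μ := hX.integrable one_le_two
  have hsq : Integrable (fun ω => 1 + X ω ^ 2) μ := (integrable_const 1).add hX.integrable_sq
  rw [eLpNorm_one_eq_lintegral_enorm, ← ofReal_integral_norm_eq_lintegral_enorm hint,
    variance_of_integral_eq_zero hint.aemeasurable hmean]
  refine ENNReal.ofReal_le_ofReal ?_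
  calc ∫ ω, ‖X ω‖ ∂μ ≤ ∫ ω, 1 + X ω ^ 2 ∂μ := integral_mono hint.norm hsq fun ω => by
        dsimp only
        rw [Real.norm_eq_abs, ← sq_abs]
        nlinarith [sq_nonneg (|X ω| - 1), sq_nonneg |X ω|]
    _ = 1 + ∫ ω, X ω ^ 2 ∂μ := by
        rw [integral_add (integrable_const 1) hX.integrable_sq, integral_const, probReal_univ,
          one_smul]

theorem ae_exists_tendsto_sum_of_summable_variance {X : ℕ → Ω → ℝ} (hm : ∀ i, Measurable (X i))
    (hL2 : ∀ i, MemLp (X i) 2 μ) (hind : iIndepFun X μ) (hmean : ∀ i, ∫ ω, X i ω ∂μ = 0)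
    (hvar : Summable fun i => Var[X i; μ]) :
    ∀ᵐ ω ∂μ, ∃ c, Tendsto (fun n => ∑ i ∈ Finset.range n, X i ω) atTop (𝓝 c) := by
  have hint : ∀ i, Integrable (X i) μ := fun i => (hL2 i).integrable one_le_two
  have hmart := martingale_sum_range_succ (fun i => (hm i).stronglyMeasurable) hint hind hmean
  have hbdd : ∀ n, eLpNorm (∑ i ∈ Finset.range (n + 1), X i) 1 μ ≤
      (1 + ∑' i, Var[X i; μ]).toNNReal := by
    intro n
    refine (eLpNorm_one_le_one_add_variance (memLp_finsetSum' _ fun i _ => hL2 i) ?_).trans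
      (ENNReal.ofReal_le_ofReal ?_)
    · simp only [Finset.sum_apply, integral_finsetSum _ fun i _ => hint i, hmean,
        Finset.sum_const_zero]
    · rw [IndepFun.variance_sum (fun i _ => hL2 i) fun i _ j _ hij => hind.indepFun hij]
      gcongr
      exact hvar.sum_le_tsum _ fun i _ => variance_nonneg _ _
  filter_upwards [hmart.submartingale.exists_ae_tendsto_of_bdd hbdd] with ω ⟨c, hc⟩
  exact ⟨c, (tendsto_add_atTop_iff_nat 1).1 (hc.congr fun n => Finset.sum_apply _ _ _)⟩

end IndependentSeries

section YuleProcess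

variable {Ω : Type*} [MeasurableSpace Ω] {μ : Measure Ω} {β : ℝ} {W : ℕ → Ω → ℝ}

theorem ae_monotone_creationTime
    (hlaw : ∀ i : ℕ, HasLaw (W i) (expMeasure (β * (i + 1))) μ) :
    ∀ᵐ ω ∂μ, Monotone fun k => creationTime W k ω := by
  have hpos : ∀ i, ∀ᵐ ω ∂μ, 0 < W i ω := fun i =>
    ae_of_ae_map (hlaw i).aemeasurable ((hlaw i).map_eq ▸ ae_pos_expMeasure _)
  filter_upwards [ae_all_iff.2 hpos] with ω hω
  refine monotone_nat_of_le_succ fun k => ?_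
  rw [creationTime, creationTime, Finset.sum_range_succ]
  exact le_add_of_nonneg_right (hω k).le

variable {r : ℝ} {X : Ω → ℝ}

theorem integral_sq_of_hasLaw_expMeasure (hr : 0 < r) (hX : HasLaw X (expMeasure r) μ) :
    ∫ ω, X ω ^ 2 ∂μ = 2 / r ^ 2 := by
  rw [← integral_sq_expMeasure hr]
  exact hX.integral_comp (f := fun x => x ^ 2) (by fun_prop)

theorem memLp_two_of_hasLaw_expMeasure (hr : 0 < r) (hX : HasLaw X (expMeasure r) μ) :
    MemLp X 2 μ := by
  refine (memLp_two_iff_integrable_sq hX.aemeasurable.aestronglyMeasurable).2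
    (.of_integral_ne_zero ?_)
  rw [integral_sq_of_hasLaw_expMeasure hr hX]
  positivity

theorem variance_le_of_hasLaw_expMeasure [IsProbabilityMeasure μ] (hr : 0 < r)
    (hX : HasLaw X (expMeasure r) μ) : Var[X; μ] ≤ 2 / r ^ 2 :=
  (variance_le_expectation_sq hX.aemeasurable.aestronglyMeasurable).trans_eq
    (integral_sq_of_hasLaw_expMeasure hr hX)

theorem sum_range_one_div_mul_add_one (β : ℝ) (k : ℕ) :
    ∑ i ∈ Finset.range k, 1 / (β * ((i : ℝ) + 1)) = harmonic k / β := by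
  rw [harmonic, Rat.cast_sum, Finset.sum_div]
  refine Finset.sum_congr rfl fun i _ => ?_
  push_cast
  rw [one_div, mul_comm, mul_inv, div_eq_mul_inv]

theorem summable_variance_sub_const [IsProbabilityMeasure μ] (hβ : 0 < β)
    (hlaw : ∀ i : ℕ, HasLaw (W i) (expMeasure (β * (i + 1))) μ) (a : ℕ → ℝ) :
    Summable fun i : ℕ => Var[fun ω => W i ω - a i; μ] := by
  have hsq : Summable fun i : ℕ => 2 / β ^ 2 * ((((i + 1 : ℕ) : ℝ) ^ 2)⁻¹) :=
    ((summable_nat_add_iff 1).2 (Real.summable_nat_pow_inv.2 one_lt_two)).mul_left _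
  refine hsq.of_nonneg_of_le (fun i => variance_nonneg _ _) fun i => ?_
  rw [variance_sub_const (hlaw i).aemeasurable.aestronglyMeasurable]
  refine (variance_le_of_hasLaw_expMeasure (by positivity) (hlaw i)).trans_eq ?_
  rw [mul_pow, Nat.cast_succ, div_mul_eq_div_div, div_eq_mul_inv (2 / β ^ 2)]

-- The `k`-th creation time has mean `harmonic k / β`.
theorem ae_exists_tendsto_creationTime_sub_log [IsProbabilityMeasure μ] (hβ : 0 < β)
    (hm : ∀ i, Measurable (W i)) (hlaw : ∀ i : ℕ, HasLaw (W i) (expMeasure (β * (i + 1))) μ)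
    (hind : iIndepFun W μ) :
    ∀ᵐ ω ∂μ, ∃ c,
      Tendsto (fun k : ℕ => creationTime W k ω - Real.log (k + 1) / β) atTop (𝓝 c) := by
  have hrate : ∀ i : ℕ, 0 < β * ((i : ℝ) + 1) := fun i => by positivity
  have hL2 : ∀ i, MemLp (W i) 2 μ := fun i => memLp_two_of_hasLaw_expMeasure (hrate i) (hlaw i)
  have hmean : ∀ i : ℕ, ∫ ω, W i ω - 1 / (β * (i + 1)) ∂μ = 0 := fun i => by
    rw [integral_sub ((hL2 i).integrable one_le_two) (integrable_const _), (hlaw i).integral_eq,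
      integral_id_expMeasure (hrate i), integral_const, probReal_univ, one_smul, sub_self]
  have hindep : iIndepFun (fun (i : ℕ) ω => W i ω - 1 / (β * (i + 1))) μ :=
    hind.comp (fun (i : ℕ) x => x - 1 / (β * (i + 1))) fun i => measurable_id.sub_const _
  have hconv := ae_exists_tendsto_sum_of_summable_variance
    (X := fun i ω => W i ω - 1 / (β * (i + 1))) (fun i => (hm i).sub_const _)
    (fun i => (hL2 i).sub (memLp_const _)) hindep hmean (summable_variance_sub_const hβ hlaw _)
  filter_upwards [hconv] with ω ⟨c, hc⟩
  refine ⟨_, (hc.add (Real.tendsto_harmonic_sub_log_add_one.div_const β)).congr fun k => ?_⟩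
  rw [Finset.sum_sub_distrib, sum_range_one_div_mul_add_one, creationTime]
  ring

end YuleProcess

/-! ### Evaluation at an independent random time -/

theorem integral_prodMk_of_indepFun {Ω α β E : Type*} {mΩ : MeasurableSpace Ω}
    {mα : MeasurableSpace α} {mβ : MeasurableSpace β} [NormedAddCommGroup E] [NormedSpace ℝ E]
    {μ : Measure Ω} [IsFiniteMeasure μ] {Y : Ω → α} {Z : Ω → β} {f : α × β → E}
    (hYZ : IndepFun Y Z μ) (hY : Measurable Y) (hZ : Measurable Z) (hf : StronglyMeasurable f)
    (hint : Integrable f ((μ.map Y).prod (μ.map Z))) :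
    ∫ ω, f (Y ω, Z ω) ∂μ = ∫ ω, ∫ ω', f (Y ω, Z ω') ∂μ ∂μ := by
  have hjoint := (indepFun_iff_map_prod_eq_prod_map_map hY.aemeasurable hZ.aemeasurable).1 hYZ
  have hinner : ∀ y, ∫ z, f (y, z) ∂μ.map Z = ∫ ω', f (y, Z ω') ∂μ := fun y =>
    integral_map hZ.aemeasurable (hf.comp_measurable measurable_prodMk_left).aestronglyMeasurable
  rw [← integral_map (hY.prodMk hZ).aemeasurable hf.aestronglyMeasurable, hjoint,
    integral_prod _ hint, integral_map hY.aemeasurable hint.integral_prod_left.aestronglyMeasurable]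
  simp only [hinner]

section RandomTime

variable {Ω Ω' : Type*}

theorem measurable_eval_toNNReal {_ : MeasurableSpace Ω} {X : ℝ≥0 → Ω → ℕ} {s : Ω → ℝ}
    (hX : ∀ t, Measurable (X t))
    (hcont : ∀ ω t, ContinuousWithinAt (fun u => X u ω) (Set.Ici t) t) (hs : Measurable s) :
    Measurable fun ω => X (s ω).toNNReal ω :=
  (measurable_uncurry_of_continuousWithinAt_Ici hX hcont).comp
    (hs.real_toNNReal.prodMk measurable_id)

theorem setIntegral_eval_eq_integral_stateProb_mul {mΩ : MeasurableSpace Ω}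
    {mΩ' : MeasurableSpace Ω'} {μ : Measure Ω} [IsFiniteMeasure μ] {X : ℝ≥0 → Ω' → ℕ}
    {Z : Ω → Ω'} {s w : Ω → ℝ} (hX : ∀ t, Measurable (X t))
    (hcont : ∀ ω t, ContinuousWithinAt (fun u => X u ω) (Set.Ici t) t) (hZ : Measurable Z)
    (hs : Measurable s) (hw : Measurable w) (hint : Integrable w μ)
    (hind : IndepFun (fun ω => (s ω, w ω)) Z μ) (n : ℕ) :
    ∫ ω in {ω | X (s ω).toNNReal (Z ω) = n}, w ω ∂μ =
      ∫ ω, stateProb μ (fun t => X t ∘ Z) n (s ω) * w ω ∂μ := by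
  have hA : MeasurableSet {q : (ℝ × ℝ) × Ω' | X q.1.1.toNNReal q.2 = n} :=
    measurable_eval_toNNReal (fun t => (hX t).comp measurable_snd) (fun q => hcont q.2)
      (measurable_fst.comp measurable_fst) (measurableSet_singleton n)
  have hw_map : Integrable (fun y : ℝ × ℝ => y.2) (μ.map fun ω => (s ω, w ω)) :=
    (integrable_map_measure measurable_snd.aestronglyMeasurable
      (hs.prodMk hw).aemeasurable).2 hint
  have hprod := integral_prodMk_of_indepFun hind (hs.prodMk hw) hZ
    ((measurable_snd.comp measurable_fst).stronglyMeasurable.indicator hA)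
    ((hw_map.comp_fst _).indicator hA)
  have hset : MeasurableSet {ω | X (s ω).toNNReal (Z ω) = n} :=
    measurable_eval_toNNReal (fun t => (hX t).comp hZ) (fun ω => hcont (Z ω)) hs
      (measurableSet_singleton n)
  rw [← integral_indicator hset]
  refine hprod.trans (integral_congr_ae (ae_of_all _ fun ω => ?_))
  have hstate : MeasurableSet {ω' | X (s ω).toNNReal (Z ω') = n} :=
    (hX _).comp hZ (measurableSet_singleton n)
  exact integral_indicator_const (w ω) hstate

end RandomTime

/-! ### The size of a uniformly chosen webpage -/

theorem measureReal_inter_eq_setIntegral_condExp {Ω : Type*} {m mΩ : MeasurableSpace Ω}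
    {μ : Measure Ω} [IsFiniteMeasure μ] (hm : m ≤ mΩ) {A B : Set Ω} (hA : MeasurableSet[m] A)
    (hB : MeasurableSet B) : μ.real (A ∩ B) = ∫ ω in A, (μ⟦B | m⟧) ω ∂μ := by
  rw [setIntegral_condExp hm ((integrable_const 1).indicator hB) hA,
    setIntegral_indicator hB, setIntegral_const, smul_eq_mul, mul_one]

theorem hasSum_measureReal_inter_preimage {Ω : Type*} {mΩ : MeasurableSpace Ω} {μ : Measure Ω}
    [IsFiniteMeasure μ] {ι : Type*} [Countable ι] [MeasurableSpace ι] [MeasurableSingletonClass ι]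
    {K : Ω → ι} (hK : Measurable K) {A : Set Ω} (hA : MeasurableSet A) :
    HasSum (fun k => μ.real (A ∩ K ⁻¹' {k})) (μ.real A) := by
  have hm : ∀ k, MeasurableSet (A ∩ K ⁻¹' {k}) := fun k => hA.inter (hK (measurableSet_singleton k))
  have hdisj : Pairwise (Function.onFun Disjoint fun k => A ∩ K ⁻¹' {k}) := fun i j hij =>
    ((pairwise_disjoint_fiber K hij).inter_left' A).inter_right' A
  have hunion : ⋃ k, A ∩ K ⁻¹' {k} = A := by
    rw [← Set.inter_iUnion, ← Set.preimage_iUnion, Set.iUnion_of_singleton, Set.preimage_univ,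
      Set.inter_univ]
  have htsum : ∑' k, μ (A ∩ K ⁻¹' {k}) = μ A := by rw [← measure_iUnion hdisj hm, hunion]
  have hsum := ENNReal.hasSum_toReal (htsum ▸ measure_ne_top μ A)
  rwa [← ENNReal.tsum_toReal_eq fun k => measure_ne_top μ _, htsum] at hsum

section PageSize

variable {Ω : Type*} {W : ℕ → Ω → ℝ} {M : ℕ → ℝ≥0 → Ω → ℕ} {t : ℝ≥0}

theorem measurable_holding_networkSigma (i : ℕ) : Measurable[networkSigma W M] (W i) :=
  (comap_measurable (W i)).mono (le_iSup (componentSigma W M) (Sum.inl i)) le_rfl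

theorem measurable_link_componentSigma (k : ℕ) (s : ℝ≥0) :
    Measurable[componentSigma W M (Sum.inr k)] (M k s) :=
  (comap_measurable (M k s)).mono
    (le_iSup (fun s => MeasurableSpace.comap (M k s) inferInstance) s) le_rfl

section

variable {m : MeasurableSpace Ω}

theorem measurable_creationTime (hW : ∀ i, Measurable (W i)) (k : ℕ) :
    Measurable (creationTime W k) :=
  Finset.measurable_sum (Finset.range k) fun i _ => hW i

theorem measurable_pagesAt (hW : ∀ i, Measurable (W i)) (t : ℝ≥0) : Measurable (pagesAt W t) :=
  measurable_set_iff.2 fun k =>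
    measurableSet_setOfPred.1 (measurableSet_le (measurable_creationTime hW k) measurable_const)

open Classical in
/-- The conditional probability, given the network, of choosing webpage `k` at time `t`. -/
def pageWeight (W : ℕ → Ω → ℝ) (t : ℝ≥0) (k : ℕ) (ω : Ω) : ℝ :=
  if k ∈ pagesAt W t ω then ((pagesAt W t ω).ncard : ℝ)⁻¹ else 0

theorem pageWeight_nonneg (k : ℕ) (ω : Ω) : 0 ≤ pageWeight W t k ω := by
  unfold pageWeight
  split_ifs <;> positivity

theorem pageWeight_le_one (k : ℕ) (ω : Ω) : pageWeight W t k ω ≤ 1 := by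
  unfold pageWeight
  split_ifs
  exacts [Nat.cast_inv_le_one _, zero_le_one]

theorem measurable_pageWeight (hW : ∀ i, Measurable (W i)) (t : ℝ≥0) (k : ℕ) :
    Measurable (pageWeight W t k) := by
  classical
  exact Measurable.ite (measurableSet_le (measurable_creationTime hW k) measurable_const)
    ((measurable_from_nat (f := fun n : ℕ => (n : ℝ)⁻¹)).comp
      (measurable_ncard.comp (measurable_pagesAt hW t))) measurable_const

/-- The average of `g` over the ages of the webpages present at time `t`. Once the creation times
increase to infinity, the webpages present are those with the numbers below `ncard`. -/
def ageAverage (W : ℕ → Ω → ℝ) (g : ℝ → ℝ) (t : ℝ≥0) (ω : Ω) : ℝ :=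
  ((pagesAt W t ω).ncard : ℝ)⁻¹ *
    ∑ k ∈ Finset.range (pagesAt W t ω).ncard, g (t - creationTime W k ω)

theorem measurable_ageAverage (hW : ∀ i, Measurable (W i)) {g : ℝ → ℝ} (hg : Measurable g)
    (t : ℝ≥0) : Measurable (ageAverage W g t) := by
  have hsum : Measurable fun p : ℕ × Ω =>
      (p.1 : ℝ)⁻¹ * ∑ k ∈ Finset.range p.1, g (t - creationTime W k p.2) :=
    measurable_from_prod_countable_right fun m => (Finset.measurable_sum (Finset.range m)
      fun k _ => hg.comp (measurable_const.sub (measurable_creationTime hW k))).const_mul (m : ℝ)⁻¹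
  exact hsum.comp ((measurable_ncard.comp (measurable_pagesAt hW t)).prodMk measurable_id)

theorem abs_ageAverage_le {g : ℝ → ℝ} {C : ℝ} (hC : ∀ s, |g s| ≤ C) (t : ℝ≥0) (ω : Ω) :
    |ageAverage W g t ω| ≤ C := by
  have hC0 : 0 ≤ C := (abs_nonneg _).trans (hC 0)
  rw [ageAverage, abs_mul, abs_of_nonneg (by positivity : (0 : ℝ) ≤ ((pagesAt W t ω).ncard : ℝ)⁻¹)]
  calc _ ≤ ((pagesAt W t ω).ncard : ℝ)⁻¹ * ((pagesAt W t ω).ncard * C) := by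
        gcongr
        refine (Finset.abs_sum_le_sum_abs _ _).trans ((Finset.sum_le_sum fun k _ => hC _).trans ?_)
        simp
    _ ≤ C := by
        rw [← mul_assoc]
        exact mul_le_of_le_one_left hC0 inv_mul_le_one

theorem hasSum_mul_pageWeight {ω : Ω} (hmono : Monotone fun k => creationTime W k ω)
    (htop : Tendsto (fun k => creationTime W k ω) atTop atTop) (g : ℝ → ℝ) :
    HasSum (fun k => g (t - creationTime W k ω) * pageWeight W t k ω) (ageAverage W g t ω) := by
  have hmem : ∀ k, k ∈ pagesAt W t ω ↔ k ∈ Finset.range (pagesAt W t ω).ncard := fun k => by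
    rw [Finset.mem_range]
    exact le_iff_lt_ncard hmono htop t k
  have havg : ageAverage W g t ω = ∑ k ∈ Finset.range (pagesAt W t ω).ncard,
      g (t - creationTime W k ω) * pageWeight W t k ω := by
    rw [ageAverage, Finset.mul_sum]
    refine Finset.sum_congr rfl fun k hk => ?_
    rw [pageWeight, if_pos ((hmem k).2 hk), mul_comm]
  rw [havg]
  refine hasSum_sum_of_ne_finset_zero fun k hk => ?_
  rw [pageWeight, if_neg (mt (hmem k).1 hk), mul_zero]

end

namespace IsGeneralizedYuleModel

variable [MeasurableSpace Ω] {μ : Measure Ω} {β ν : ℝ} {r : ℕ → ℝ}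

theorem componentSigma_le (h : IsGeneralizedYuleModel μ β ν r W M) (i : ℕ ⊕ ℕ) :
    componentSigma W M i ≤ ‹MeasurableSpace Ω› := by
  rcases i with i | k
  · exact (h.measurable_holding i).comap_le
  · exact iSup_le fun s => ((h.birth k).measurable s).comap_le

theorem networkSigma_le (h : IsGeneralizedYuleModel μ β ν r W M) :
    networkSigma W M ≤ ‹MeasurableSpace Ω› :=
  iSup_le h.componentSigma_le

theorem indep_holding_link (h : IsGeneralizedYuleModel μ β ν r W M) (k : ℕ) :
    Indep (⨆ i, componentSigma W M (Sum.inl i)) (componentSigma W M (Sum.inr k)) μ := by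
  have hdisj := indep_iSup_of_disjoint h.componentSigma_le h.indep
    (S := Set.range Sum.inl) (T := {Sum.inr k}) (by simp)
  rwa [iSup_range, iSup_singleton] at hdisj

theorem iIndepFun_holding (h : IsGeneralizedYuleModel μ β ν r W M) : iIndepFun W μ :=
  (iIndepFun_iff_iIndep _ _ _).2 (h.indep.precomp Sum.inl_injective)

theorem measurable_linkAt (h : IsGeneralizedYuleModel μ β ν r W M) (t : ℝ≥0) (k : ℕ) :
    Measurable[networkSigma W M] fun ω => M k (t - creationTime W k ω).toNNReal ω :=
  measurable_eval_toNNReal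
    (fun s => (measurable_link_componentSigma k s).mono
      (le_iSup (componentSigma W M) (Sum.inr k)) le_rfl)
    (h.birth k).rightCont
    (measurable_const.sub (measurable_creationTime measurable_holding_networkSigma k))

variable {K : Ω → ℕ}

theorem measurable_pageSize (h : IsGeneralizedYuleModel μ β ν r W M)
    (hK : IsUniformPage μ W M t K) : Measurable (pageSize W M t K) := by
  have hsize : Measurable fun p : ℕ × Ω =>
      M p.1 ((t : ℝ) - creationTime W p.1 p.2).toNNReal p.2 :=
    measurable_from_prod_countable_right fun k =>
      (h.measurable_linkAt t k).mono h.networkSigma_le le_rfl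
  exact hsize.comp (hK.measurable.prodMk measurable_id)

variable [IsProbabilityMeasure μ]

theorem integrable_pageWeight (h : IsGeneralizedYuleModel μ β ν r W M) (t : ℝ≥0) (k : ℕ) :
    Integrable (pageWeight W t k) μ :=
  .of_bound (measurable_pageWeight h.measurable_holding t k).aestronglyMeasurable 1
    (ae_of_all _ fun ω => by
      rw [Real.norm_of_nonneg (pageWeight_nonneg k ω)]
      exact pageWeight_le_one k ω)

theorem setIntegral_pageWeight (h : IsGeneralizedYuleModel μ β ν r W M) (t : ℝ≥0) (n k : ℕ) :
    ∫ ω in {ω | M k (t - creationTime W k ω).toNNReal ω = n}, pageWeight W t k ω ∂μ =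
      ∫ ω, stateProb μ (M k) n (t - creationTime W k ω) * pageWeight W t k ω ∂μ := by
  have hW : ∀ i, Measurable[⨆ i, componentSigma W M (Sum.inl i)] (W i) := fun i =>
    (comap_measurable (W i)).mono
      (le_iSup (fun i => componentSigma W M (Sum.inl i)) i) le_rfl
  have hY : Measurable[⨆ i, componentSigma W M (Sum.inl i)]
      fun ω => (t - creationTime W k ω, pageWeight W t k ω) :=
    (measurable_const.sub (measurable_creationTime hW k)).prodMk (measurable_pageWeight hW t k)
  refine setIntegral_eval_eq_integral_stateProb_mul (mΩ' := componentSigma W M (Sum.inr k))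
    (measurable_link_componentSigma k) (h.birth k).rightCont
    (measurable_id'' (h.componentSigma_le _))
    (measurable_const.sub (measurable_creationTime h.measurable_holding k))
    (measurable_pageWeight h.measurable_holding t k) (h.integrable_pageWeight t k) ?_ n
  refine (IndepFun_iff_Indep (mγ := componentSigma W M (Sum.inr k)) _ _ μ).2 ?_
  rw [MeasurableSpace.comap_id]
  exact indep_of_indep_of_le_left (h.indep_holding_link k) hY.comap_le

theorem measureReal_pageSize_inter (h : IsGeneralizedYuleModel μ β ν r W M)
    (hK : IsUniformPage μ W M t K) (n k : ℕ) :
    μ.real ({ω | pageSize W M t K ω = n} ∩ K ⁻¹' {k}) =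
      ∫ ω, stateProb μ (M k) n (t - creationTime W k ω) * pageWeight W t k ω ∂μ := by
  have hinter : {ω | pageSize W M t K ω = n} ∩ K ⁻¹' {k} =
      {ω | M k (t - creationTime W k ω).toNNReal ω = n} ∩ K ⁻¹' {k} := by
    ext ω
    refine and_congr_left fun hω => ?_
    rw [Set.mem_ofPred_eq, pageSize, show K ω = k from hω]
    rfl
  have hlink : MeasurableSet[networkSigma W M]
      {ω | M k (t - creationTime W k ω).toNNReal ω = n} :=
    h.measurable_linkAt t k (measurableSet_singleton n)
  rw [hinter, measureReal_inter_eq_setIntegral_condExp h.networkSigma_le hlink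
    (hK.measurable (measurableSet_singleton k)), ← h.setIntegral_pageWeight]
  exact integral_congr_ae (ae_restrict_of_ae (hK.uniform k))

theorem ae_monotone_and_exists_tendsto_creationTime (h : IsGeneralizedYuleModel μ β ν r W M)
    (hβ : 0 < β) :
    ∀ᵐ ω ∂μ, (Monotone fun k => creationTime W k ω) ∧ ∃ c,
      Tendsto (fun k : ℕ => creationTime W k ω - Real.log (k + 1) / β) atTop (𝓝 c) :=
  (ae_monotone_creationTime h.law_holding).and
    (ae_exists_tendsto_creationTime_sub_log hβ h.measurable_holding h.law_holding
      h.iIndepFun_holding)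

theorem measureReal_pageSize_eq (h : IsGeneralizedYuleModel μ β ν r W M) (hβ : 0 < β)
    (h0 : 0 < ν) (h1 : ν ≤ 1) (hK : IsUniformPage μ W M t K) (n : ℕ) :
    μ.real {ω | pageSize W M t K ω = n} =
      ∫ ω, ageAverage W (stateProb μ (M 0) n) t ω ∂μ := by
  have hpart := hasSum_measureReal_inter_preimage (μ := μ) hK.measurable
    (h.measurable_pageSize hK (measurableSet_singleton n))
  have hterm : ∀ k, μ.real (pageSize W M t K ⁻¹' {n} ∩ K ⁻¹' {k}) =
      ∫ ω, stateProb μ (M 0) n (t - creationTime W k ω) * pageWeight W t k ω ∂μ := fun k =>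
    (h.measureReal_pageSize_inter hK n k).trans
      (by rw [(h.birth k).stateProb_unique (h.birth 0) h0 h1 n])
  have hnonneg : ∀ k ω,
      0 ≤ stateProb μ (M 0) n (t - creationTime W k ω) * pageWeight W t k ω := fun k ω =>
    mul_nonneg measureReal_nonneg (pageWeight_nonneg k ω)
  have hint : ∀ k, Integrable
      (fun ω => stateProb μ (M 0) n (t - creationTime W k ω) * pageWeight W t k ω) μ := fun k =>
    (h.integrable_pageWeight t k).bdd_mul
      (((h.birth 0).continuous_stateProb n).measurable.comp (measurable_const.sub
        (measurable_creationTime h.measurable_holding k))).aestronglyMeasurable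
      (ae_of_all _ fun ω => abs_stateProb_le_one n _)
  have havg : ∀ᵐ ω ∂μ, ageAverage W (stateProb μ (M 0) n) t ω =
      ∑' k, stateProb μ (M 0) n (t - creationTime W k ω) * pageWeight W t k ω := by
    filter_upwards [h.ae_monotone_and_exists_tendsto_creationTime hβ] with ω ⟨hmono, c, hc⟩
    exact (hasSum_mul_pageWeight hmono (tendsto_atTop_of_tendsto_sub_log hβ hc) _).tsum_eq.symm
  simp only [hterm] at hpart
  rw [integral_congr_ae havg]
  exact hpart.unique (hasSum_integral_of_summable_integral_norm hint
    (hpart.summable.congr fun k => integral_congr_ae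
      (ae_of_all _ fun ω => (Real.norm_of_nonneg (hnonneg k ω)).symm)))

theorem tendsto_measureReal_pageSize (h : IsGeneralizedYuleModel μ β ν r W M) (hβ : 0 < β)
    (h0 : 0 < ν) (h1 : ν ≤ 1) {K : ℝ≥0 → Ω → ℕ} (hK : ∀ t, IsUniformPage μ W M t (K t)) (n : ℕ) :
    Tendsto (fun t : ℝ≥0 => μ.real {ω | pageSize W M t (K t) ω = n}) atTop
      (𝓝 (∫ s, stateProb μ (M 0) n s ∂expMeasure β)) := by
  have hcont := (h.birth 0).continuous_stateProb n
  simp only [fun t => h.measureReal_pageSize_eq hβ h0 h1 (hK t) n]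
  have hlim : Tendsto (fun t : ℝ≥0 => ∫ ω, ageAverage W (stateProb μ (M 0) n) t ω ∂μ) atTop
      (𝓝 (∫ _ : Ω, (∫ s, stateProb μ (M 0) n s ∂expMeasure β) ∂μ)) := by
    refine tendsto_integral_filter_of_dominated_convergence (fun _ => 1)
      (Eventually.of_forall fun t => (measurable_ageAverage h.measurable_holding hcont.measurable
        t).aestronglyMeasurable)
      (Eventually.of_forall fun t => ae_of_all _
        (abs_ageAverage_le (abs_stateProb_le_one n) t))
      (integrable_const 1) ?_
    filter_upwards [h.ae_monotone_and_exists_tendsto_creationTime hβ] with ω ⟨hmono, c, hc⟩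
    exact (tendsto_average_ages hβ hmono hc hcont (abs_stateProb_le_one n)).comp
      (NNReal.tendsto_coe_atTop.2 tendsto_id)
  simpa only [integral_const, probReal_univ, one_smul] using hlim

end IsGeneralizedYuleModel

end PageSize

/-! ### Saturating rates -/

section AlternatingSums

variable {𝕜 : Type*} [Field 𝕜] {n : ℕ} {y : 𝕜}

theorem fwdDiff_iter_inv (h : 𝕜) (hy : ∀ k ∈ Finset.range (n + 1), y + k * h ≠ 0) :
    (fwdDiff h)^[n] (·⁻¹) y =
      (-1) ^ n * n.factorial * h ^ n / ∏ k ∈ Finset.range (n + 1), (y + k * h) := by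
  induction n generalizing y with
  | zero => simp
  | succ n ih =>
    have hshift : ∀ k : ℕ, y + h + k * h = y + (k + 1 : ℕ) * h := fun k => by push_cast; ring
    have hy_init : ∀ k ∈ Finset.range (n + 1), y + k * h ≠ 0 := fun k hk =>
      hy k (Finset.mem_range.2 (Nat.lt_succ_of_lt (Finset.mem_range.1 hk)))
    have hy_tail : ∀ k ∈ Finset.range (n + 1), y + h + k * h ≠ 0 := fun k hk =>
      hshift k ▸ hy (k + 1) (Finset.mem_range.2 (Nat.succ_lt_succ (Finset.mem_range.1 hk)))
    have hlast := hy (n + 1) (Finset.self_mem_range_succ _)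
    have hinit := Finset.prod_ne_zero_iff.2 hy_init
    have htail := Finset.prod_ne_zero_iff.2 hy_tail
    have hprod : (∏ k ∈ Finset.range (n + 1), (y + k * h)) * (y + (n + 1 : ℕ) * h) =
        (∏ k ∈ Finset.range (n + 1), (y + h + k * h)) * (y + (0 : ℕ) * h) := by
      rw [← Finset.prod_range_succ (fun k : ℕ => y + k * h), Finset.prod_range_succ']
      simp only [hshift]
    rw [Function.iterate_succ_apply', fwdDiff, ih hy_init, ih hy_tail,
      Finset.prod_range_succ _ (n + 1), div_sub_div _ _ htail hinit,
      div_eq_div_iff (mul_ne_zero htail hinit) (mul_ne_zero hinit hlast), Nat.factorial_succ]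
    push_cast at hprod ⊢
    linear_combination (-1) ^ n * n.factorial * h ^ n *
      (∏ k ∈ Finset.range (n + 1), (y + k * h)) * hprod

theorem sum_choose_mul_one_div_sub (x : 𝕜) (hy : ∀ k ∈ Finset.range (n + 1), y - k * x ≠ 0) :
    ∑ k ∈ Finset.range (n + 1), (n.choose k : 𝕜) * (-1) ^ (n - k) * (1 / (y - k * x)) =
      n.factorial * x ^ n / ∏ k ∈ Finset.range (n + 1), (y - k * x) := by
  have hneg : ∀ k : ℕ, y - k * x = y + k * -x := fun k => by ring
  simp only [hneg] at hy ⊢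
  rw [mul_comm (n.factorial : 𝕜), ← neg_neg x, neg_pow (-x), neg_neg, mul_right_comm,
    ← fwdDiff_iter_inv _ hy, fwdDiff_iter_eq_sum_shift]
  refine Finset.sum_congr rfl fun k _ => ?_
  rw [zsmul_eq_mul, nsmul_eq_mul, one_div]
  push_cast
  ring

end AlternatingSums

theorem saturatingRate_nonneg {lam : ℝ} (hlam : 0 ≤ lam) (N n : ℕ) :
    0 ≤ saturatingRate lam N n :=
  mul_nonneg hlam (Nat.cast_nonneg _)

theorem prod_range_mul_natCast_sub (x : ℝ) (N n : ℕ) :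
    ∏ k ∈ Finset.range n, x * ((N - k : ℕ) : ℝ) = x ^ n * (n.factorial * N.choose n) := by
  rw [Finset.prod_mul_distrib, Finset.prod_const, Finset.card_range, ← Nat.cast_prod,
    ← Nat.descFactorial_eq_prod_range, Nat.descFactorial_eq_factorial_mul_choose, Nat.cast_mul]

section SaturatingWeights

variable {b lam : ℝ} {L j : ℕ}

theorem add_saturatingRate_succ (hb : b ≠ 0) (hjL : j ≤ L) :
    b + saturatingRate lam (L + 1) (j + 1) = b * (1 + lam / b * L - j * (lam / b)) := by
  rw [saturatingRate, Nat.add_sub_add_right, Nat.cast_sub hjL]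
  field_simp
  ring

theorem div_mul_prod_saturatingRate (hb : b ≠ 0) (hjL : j ≤ L) :
    b / (b + saturatingRate lam (L + 1) (j + 1)) * ∏ m ∈ Finset.Ico 1 (j + 1),
        saturatingRate lam (L + 1) m / (b + saturatingRate lam (L + 1) m) =
      (lam / b) ^ j * (j.factorial * L.choose j) /
        ∏ k ∈ Finset.range (j + 1), (1 + lam / b * L - k * (lam / b)) := by
  have hfactor : ∀ k ∈ Finset.range j, saturatingRate lam (L + 1) (1 + k) /
      (b + saturatingRate lam (L + 1) (1 + k)) =
        lam / b * (L - k : ℕ) / (1 + lam / b * L - k * (lam / b)) := fun k hk => by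
    rw [add_comm 1, add_saturatingRate_succ hb ((Finset.mem_range.1 hk).le.trans hjL),
      saturatingRate, Nat.add_sub_add_right, ← div_div, mul_div_right_comm]
  rw [Finset.prod_Ico_eq_prod_range, Nat.add_sub_cancel, Finset.prod_congr rfl hfactor,
    Finset.prod_div_distrib, prod_range_mul_natCast_sub, add_saturatingRate_succ hb hjL, ← div_div,
    div_self hb, div_mul_div_comm, one_mul, Finset.prod_range_succ, mul_comm (_ - _)]

theorem div_mul_prod_saturatingRate_eq_sum (hb : 0 < b) (hlam : 0 ≤ lam) {N n : ℕ} (hn : 1 ≤ n)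
    (hnN : n ≤ N) :
    b / (b + saturatingRate lam N n) *
        ∏ m ∈ Finset.Ico 1 n, saturatingRate lam N m / (b + saturatingRate lam N m) =
      ((N - 1).choose (N - n) : ℝ) *
        ∑ m ∈ Finset.Icc 1 n, ((n - 1).choose (m - 1) : ℝ) * (-1) ^ (n - m) *
          (1 / (1 + lam / b * ((N : ℝ) - (m : ℝ)))) := by
  obtain ⟨j, rfl⟩ := Nat.exists_eq_add_of_le' hn
  obtain ⟨L, rfl⟩ := Nat.exists_eq_add_of_le' (hn.trans hnN)
  have hjL : j ≤ L := Nat.succ_le_succ_iff.1 hnN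
  have hne : ∀ k ∈ Finset.range (j + 1), 1 + lam / b * L - k * (lam / b) ≠ 0 := fun k hk => by
    have hpos := add_pos_of_pos_of_nonneg hb (saturatingRate_nonneg hlam (L + 1) (k + 1))
    rw [add_saturatingRate_succ hb.ne' ((Finset.mem_range_succ_iff.1 hk).trans hjL)] at hpos
    exact right_ne_zero_of_mul hpos.ne'
  have hterm : ∀ k ∈ Finset.range (j + 1), ((j + 1 - 1).choose (1 + k - 1) : ℝ) *
      (-1) ^ (j + 1 - (1 + k)) * (1 / (1 + lam / b * ((L + 1 : ℕ) - (1 + k : ℕ)))) =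
        j.choose k * (-1) ^ (j - k) * (1 / (1 + lam / b * L - k * (lam / b))) := fun k _ => by
    rw [Nat.add_sub_cancel, Nat.add_sub_cancel_left, add_comm 1, Nat.add_sub_add_right]
    push_cast
    ring
  rw [div_mul_prod_saturatingRate hb.ne' hjL, ← Finset.Ico_add_one_right_eq_Icc,
    Finset.sum_Ico_eq_sum_range, Nat.add_sub_cancel (n := j + 1), Finset.sum_congr rfl hterm,
    sum_choose_mul_one_div_sub _ hne, Nat.add_sub_cancel, Nat.add_sub_add_right,
    Nat.choose_symm hjL]
  ring

end SaturatingWeights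

end FracYule

end

theorem mainTheorem6_general {Ω : Type*} [MeasurableSpace Ω] (μ : Measure Ω)
    [IsProbabilityMeasure μ] (β ν : ℝ) (r : ℕ → ℝ) (hβ : 0 < β) (hν0 : 0 < ν) (hν1 : ν ≤ 1)
    (hr : ∀ n, 0 ≤ r n) (W : ℕ → Ω → ℝ) (M : ℕ → ℝ≥0 → Ω → ℕ) (K : ℝ≥0 → Ω → ℕ)
    (hModel : FracYule.IsGeneralizedYuleModel μ β ν r W M)
    (hK : ∀ t, FracYule.IsUniformPage μ W M t (K t)) :
    ∃ π : ProbabilityMeasure ℕ,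
      (∀ n : ℕ, Tendsto (fun t : ℝ≥0 => μ.real {ω | FracYule.pageSize W M t (K t) ω = n})
        atTop (𝓝 ((π : Measure ℕ).real {n}))) ∧
      ∀ n : ℕ, 1 ≤ n → (π : Measure ℕ).real {n} =
        β ^ ν / (β ^ ν + r n) * ∏ m ∈ Finset.Ico 1 n, r m / (β ^ ν + r m) := by
  have hlaw := (hModel.birth 0).exponentialAgeLaw_real_singleton hβ
  refine ⟨⟨FracYule.exponentialAgeLaw μ (M 0) β,
    (hModel.birth 0).isProbabilityMeasure_exponentialAgeLaw hβ⟩, fun n => ?_, fun n hn => ?_⟩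
  · rw [ProbabilityMeasure.coe_mk, hlaw]
    exact hModel.tendsto_measureReal_pageSize hβ hν0 hν1 hK n
  · rw [ProbabilityMeasure.coe_mk, hlaw]
    exact (hModel.birth 0).integral_stateProb_expMeasure hν0 hν1 hr hβ hn

theorem mainTheorem6 {Ω : Type*} [MeasurableSpace Ω] (μ : Measure Ω) [IsProbabilityMeasure μ]
    (β lam ν : ℝ) (hβ : 0 < β) (hlam : 0 < lam) (hν0 : 0 < ν) (hν1 : ν ≤ 1)
    (N : ℕ) (hN : 1 ≤ N)
    (W : ℕ → Ω → ℝ) (M : ℕ → ℝ≥0 → Ω → ℕ) (K : ℝ≥0 → Ω → ℕ)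
    (hModel : FracYule.IsGeneralizedYuleModel μ β ν (FracYule.saturatingRate lam N) W M)
    (hK : ∀ t, FracYule.IsUniformPage μ W M t (K t))
    (ρ : ℝ) (hρ : ρ = lam / β ^ ν) :
    ∃ π : ProbabilityMeasure ℕ,
      (∀ n : ℕ, Tendsto (fun t : ℝ≥0 => μ.real {ω | FracYule.pageSize W M t (K t) ω = n})
        atTop (𝓝 ((π : Measure ℕ).real {n}))) ∧
      ∀ n : ℕ, 1 ≤ n → n ≤ N →
        (π : Measure ℕ).real {n} =
          ((N - 1).choose (N - n) : ℝ) *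
            ∑ m ∈ Finset.Icc 1 n, ((n - 1).choose (m - 1) : ℝ) * (-1) ^ (n - m) *
              (1 / (1 + ρ * ((N : ℝ) - (m : ℝ)))) := by
  obtain ⟨π, hlim, hlaw⟩ := mainTheorem6_general μ β ν _ hβ hν0 hν1
    (FracYule.saturatingRate_nonneg hlam.le N) W M K hModel hK
  exact ⟨π, hlim, fun n hn hnN => by
    rw [hlaw n hn, hρ, FracYule.div_mul_prod_saturatingRate_eq_sum
      (Real.rpow_pos_of_pos hβ ν) hlam.le hn hnN]⟩
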